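/- Let \(p\) be an odd prime and let \(N\) be a totally real dihedral field of degree \(2p\), i.e. a totally real number field which is Galois over \(\mathbb{Q}\) with \(\mathrm{Gal}(N/\mathbb{Q})\) isomorphic to the dihedral group of order \(2p\). Let \(K\) be the quadratic subfield of \(N\) and let \(L\) be any of the \(p\) conjugate subfields of \(N\) of degree \(p\) over \(\mathbb{Q}\). For a number field \(E\) denote by \(U_E\) its group of units, by \(\mathcal{I}_E\) its group of fractional ideals, and by \(\mathcal{P}_E\) the subgroup of principal fractional ideals. For an extension \(E/F\) of number fields of degree \(p\), regard \(\mathcal{I}_F\) and \(\mathcal{P}_F\) as subgroups of \(\mathcal{I}_E\) by extension of ideals, and put \(\mathcal{I}_{E/F}=\{\mathfrak{A}\in\mathcal{I}_E \mid \mathfrak{A}^p\in\mathcal{I}_F\}\) and \(\mathcal{P}_{E/F}=\mathcal{I}_{E/F}\cap\mathcal{P}_E\). Consider - the absolute principal factors \(\mathcal{P}_{L/\mathbb{Q}}/\mathcal{P}_{\mathbb{Q}}\), - the relative principal factors \(\ker(N_{N/L})\cap\bigl((\mathcal{P}_{N/K}\mathcal{I}_K)/\mathcal{I}_K\bigr)\),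 where \(N_{N/L}:\mathcal{I}_{N/K}/\mathcal{I}_K\to\mathcal{I}_{L/\mathbb{Q}}/\mathcal{I}_{\mathbb{Q}}\) is induced by the relative norm of ideals, - the capitulation kernel \(\ker(T_{N/K})\) of the extension homomorphism \(T_{N/K}:\mathrm{Cl}(K)\to\mathrm{Cl}(N)\) of ideal classes. Then these three groups are finite-dimensional vector spaces over \(\mathbb{F}_p\); denote their dimensions by \(A\), \(R\), \(C\), respectively. The index \((U_K:N_{N/K}(U_N))\) is a power \(p^U\) of \(p\). The numbers \(U,A,R,C\) do not depend on the choice of \(L\), and \(N\) belongs to exactly one of the following \(9\) differential principal factorization types, i.e. \((U;A,R,C)\) is exactly one of the rows \[ \begin{array}{c|c|c|ccc} \text{Type} & U & U+1=A+R+C & A & R & C\\ \hline \alpha_1 & 1 & 2 & 0 & 0 & 2\\ \alpha_2 & 1 & 2 & 0 & 1 & 1\\ \alpha_3 & 1 & 2 & 0 & 2 & 0\\ \beta_1 & 1 & 2 & 1 & 0 & 1\\ \beta_2 & 1 & 2 & 1 & 1 & 0\\ \gamma & 1 & 2 & 2 & 0 & 0\\ \hline \delta_1 & 0 & 1 & 0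 & 0 & 1\\ \delta_2 & 0 & 1 & 0 & 1 & 0\\ \varepsilon & 0 & 1 & 1 & 0 & 0 \end{array} \] The rows of this table are precisely all quadruples \((U;A,R,C)\) of non-negative integers with \(U\in\{0,1\}\) and \(U+1=A+R+C\), each occurring once in the table. -/

import Mathlib

open scoped nonZeroDivisors NumberField Pointwise

noncomputable section

namespace DPF

/-- A (multiplicatively written) commutative group `G` is an `𝔽_p`-vector space of dimension `d`,
i.e. `G ≃ 𝔽_p ^ d`. -/
def HasFpDim (p : ℕ) (G : Type*) [CommGroup G] (d : ℕ) : Prop :=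
  Nonempty (Additive G ≃+ (Fin d → ZMod p))

section Single

variable (E : Type*) [Field E] [NumberField E]

/-- The group `𝓘_E` of (nonzero) fractional ideals of the number field `E`. -/
abbrev FracIdeals : Type _ := (FractionalIdeal (𝓞 E)⁰ E)ˣ

/-- The group `𝓟_E` of principal fractional ideals of `E`. -/
def principalIdeals : Subgroup (FracIdeals E) := (toPrincipalIdeal (𝓞 E) E).range

end Single

section Relative

variable (F E : Type*) [Field F] [NumberField F] [Field E] [NumberField E] [Algebra F E]

/-- Extension of ideals `𝓘_F → 𝓘_E`, `𝔞 ↦ 𝔞 𝓞_E`. -/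
def extendIdeal : FracIdeals F →* FracIdeals E :=
  Units.map (FractionalIdeal.extendedHom (A := 𝓞 F) (K := F) E (𝓞 E) : _ →* _)

/-- `𝓘_F`, viewed as a subgroup of `𝓘_E`. -/
def baseIdeals : Subgroup (FracIdeals E) := (extendIdeal F E).range

/-- `𝓟_F`, viewed as a subgroup of `𝓘_E`. -/
def basePrincipalIdeals : Subgroup (FracIdeals E) := (principalIdeals F).map (extendIdeal F E)

/-- The group `𝓘_{E/F} = {𝔄 ∈ 𝓘_E | 𝔄 ^ p ∈ 𝓘_F}` of ambiguous ideals of `E/F`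
(where `p` is the degree of `E/F`). -/
def ambiguousIdeals (p : ℕ) : Subgroup (FracIdeals E) := (baseIdeals F E).comap (powMonoidHom p)

/-- The group `𝓟_{E/F} = 𝓘_{E/F} ∩ 𝓟_E` of ambiguous principal ideals of `E/F`. -/
def ambiguousPrincipalIdeals (p : ℕ) : Subgroup (FracIdeals E) :=
  ambiguousIdeals F E p ⊓ principalIdeals E

/-- The space `𝓟_{E/F} / 𝓟_F` of primitive ambiguous principal ideals of `E/F`. -/
abbrev PrincipalFactors (p : ℕ) : Type _ :=
  ambiguousPrincipalIdeals F E p ⧸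
    (basePrincipalIdeals F E).subgroupOf (ambiguousPrincipalIdeals F E p)

/-- The extension homomorphism `T_{E/F} : Cl(F) → Cl(E)` of ideal classes. -/
def transfer : ClassGroup (𝓞 F) →* ClassGroup (𝓞 E) := ClassGroup.extendedHom (𝓞 F) (𝓞 E)

/-- The relative norm `U_E → U_F` on unit groups. -/
def unitNorm : (𝓞 E)ˣ →* (𝓞 F)ˣ := Units.map (RingOfIntegers.norm F)

end Relative

section Norm

variable (F E : Type*) [Field F] [NumberField F] [Field E] [NumberField E] [Algebra F E]

lemma relNorm_ne_zero {a : 𝓞 E} (ha : a ≠ 0) :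
    ((Ideal.relNorm (𝓞 F) (Ideal.span {a}) : Ideal (𝓞 F)) : FractionalIdeal (𝓞 F)⁰ F) ≠ 0 := by
  rw [Ne, FractionalIdeal.coeIdeal_eq_zero, Ideal.relNorm_eq_bot_iff,
    Ideal.span_singleton_eq_bot]
  exact ha

lemma relNorm_div_eq {I : FractionalIdeal (𝓞 E)⁰ E} (a b : (𝓞 E)⁰) (I₁ I₂ : Ideal (𝓞 E))
    (ha : a • (I : Submodule (𝓞 E) E) = Submodule.map (Algebra.linearMap (𝓞 E) E) I₁)
    (hb : b • (I : Submodule (𝓞 E) E) = Submodule.map (Algebra.linearMap (𝓞 E) E) I₂) :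
    (Ideal.relNorm (𝓞 F) I₁ : FractionalIdeal (𝓞 F)⁰ F) /
        (Ideal.relNorm (𝓞 F) (Ideal.span {(a : 𝓞 E)}) : Ideal (𝓞 F)) =
      (Ideal.relNorm (𝓞 F) I₂ : FractionalIdeal (𝓞 F)⁰ F) /
        (Ideal.relNorm (𝓞 F) (Ideal.span {(b : 𝓞 E)}) : Ideal (𝓞 F)) := by
  rw [div_eq_div_iff (relNorm_ne_zero F E (nonZeroDivisors.coe_ne_zero a))
    (relNorm_ne_zero F E (nonZeroDivisors.coe_ne_zero b))]
  have h := congr_arg (b • ·) ha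
  have h' := congr_arg (a • ·) hb
  rw [smul_comm] at h
  rw [h, Submonoid.smul_def, Submonoid.smul_def, ← Submodule.ideal_span_singleton_smul,
    ← Submodule.ideal_span_singleton_smul, ← Submodule.map_smul'', ← Submodule.map_smul'',
    (LinearMap.map_injective ?_).eq_iff, smul_eq_mul, smul_eq_mul] at h'
  · rw [← FractionalIdeal.coeIdeal_mul, ← FractionalIdeal.coeIdeal_mul, ← map_mul, ← map_mul,
      mul_comm, h', mul_comm]
  · exact LinearMap.ker_eq_bot.mpr (IsFractionRing.injective (𝓞 E) E)

/-- The relative norm of fractional ideals: the multiplicative extension of Mathlib's relative norm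
`Ideal.relNorm` of integral ideals (`I = I.num / I.den` with `I.num` integral). -/
def fracRelNorm : FractionalIdeal (𝓞 E)⁰ E →* FractionalIdeal (𝓞 F)⁰ F where
  toFun I := (Ideal.relNorm (𝓞 F) I.num : FractionalIdeal (𝓞 F)⁰ F) /
    (Ideal.relNorm (𝓞 F) (Ideal.span {(I.den : 𝓞 E)}) : Ideal (𝓞 F))
  map_one' := by
    rw [relNorm_div_eq F E _ 1 _ ⊤ (FractionalIdeal.den_mul_self_eq_num _)
      (by simp [Submodule.one_eq_range])]
    simp [Ideal.relNorm_top]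
  map_mul' I J := by
    rw [relNorm_div_eq F E _ (I.den * J.den) _ (I.num * J.num)
      (FractionalIdeal.den_mul_self_eq_num _) (by
        have : Algebra.linearMap (𝓞 E) E =
          (IsScalarTower.toAlgHom (𝓞 E) (𝓞 E) E).toLinearMap := rfl
        rw [FractionalIdeal.coe_mul, this, Submodule.map_mul, ← this,
          ← FractionalIdeal.den_mul_self_eq_num, ← FractionalIdeal.den_mul_self_eq_num]
        exact Submodule.mul_smul_mul_eq_smul_mul_smul
          (I : Submodule (𝓞 E) E) (J : Submodule (𝓞 E) E) (I.den : 𝓞 E) (J.den : 𝓞 E))]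
    rw [map_mul, FractionalIdeal.coeIdeal_mul, Submonoid.coe_mul,
      ← Ideal.span_singleton_mul_span_singleton, map_mul, FractionalIdeal.coeIdeal_mul,
      mul_div_mul_comm]

/-- On integral ideals, `fracRelNorm` is `Ideal.relNorm`. -/
lemma fracRelNorm_coeIdeal (I : Ideal (𝓞 E)) :
    fracRelNorm F E (I : FractionalIdeal (𝓞 E)⁰ E) = (Ideal.relNorm (𝓞 F) I : Ideal (𝓞 F)) := by
  change (Ideal.relNorm (𝓞 F) _ : FractionalIdeal (𝓞 F)⁰ F) / (Ideal.relNorm (𝓞 F) _ : Ideal _) = _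
  rw [relNorm_div_eq F E _ 1 _ I (FractionalIdeal.den_mul_self_eq_num _) (by rw [one_smul]; rfl)]
  simp [Ideal.relNorm_top]

/-- The relative norm homomorphism `N_{E/F} : 𝓘_E → 𝓘_F`. -/
def idealNorm : FracIdeals E →* FracIdeals F := Units.map (fracRelNorm F E)

end Norm

section Square

variable (K L N : Type*) [Field K] [NumberField K] [Field L] [NumberField L] [Field N]
  [NumberField N] [Algebra K N] [Algebra L N]

/-- The subgroup of `𝓘_N` consisting of all ambiguous ideals `𝔄` of `N/K` with
`N_{N/L}(𝔄) ∈ 𝓘_ℚ`; its image in `𝓘_{N/K} / 𝓘_K` is the kernel of the map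
`N_{N/L} : 𝓘_{N/K} / 𝓘_K → 𝓘_{L/ℚ} / 𝓘_ℚ` induced by the norm, i.e. the space of relative
differential factors. -/
def relativeIdeals (p : ℕ) : Subgroup (FracIdeals N) :=
  ambiguousIdeals K N p ⊓ (baseIdeals ℚ L).comap (idealNorm L N)

/-- `ker(N_{N/L}) ∩ (𝓟_{N/K} 𝓘_K / 𝓘_K)`, as a subgroup of `𝓘_N / 𝓘_K`. -/
def relativePrincipalFactors (p : ℕ) : Subgroup (FracIdeals N ⧸ baseIdeals K N) :=
  (relativeIdeals K L N p).map (QuotientGroup.mk' (baseIdeals K N)) ⊓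
    (ambiguousPrincipalIdeals K N p ⊔ baseIdeals K N).map (QuotientGroup.mk' (baseIdeals K N))

end Square

/-- The nine differential principal factorization types of totally real dihedral fields. -/
inductive DPFType : Type
  | α₁ | α₂ | α₃ | β₁ | β₂ | γ | δ₁ | δ₂ | ε

/-- The column `U` of the table of types. -/
def DPFType.U : DPFType → ℕ
  | α₁ => 1 | α₂ => 1 | α₃ => 1 | β₁ => 1 | β₂ => 1 | γ => 1 | δ₁ => 0 | δ₂ => 0 | ε => 0

/-- The column `A` of the table of types. -/
def DPFType.A : DPFType → ℕ
  | α₁ => 0 | α₂ => 0 | α₃ => 0 | β₁ => 1 | β₂ => 1 | γ => 2 | δ₁ => 0 | δ₂ => 0 | ε => 1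

/-- The column `R` of the table of types. -/
def DPFType.R : DPFType → ℕ
  | α₁ => 0 | α₂ => 1 | α₃ => 2 | β₁ => 0 | β₂ => 1 | γ => 0 | δ₁ => 0 | δ₂ => 1 | ε => 0

/-- The column `C` of the table of types. -/
def DPFType.C : DPFType → ℕ
  | α₁ => 2 | α₂ => 1 | α₃ => 0 | β₁ => 1 | β₂ => 0 | γ => 0 | δ₁ => 1 | δ₂ => 0 | ε => 0

/-- The invariants of `N` (relative to its subfields `K` of degree `2` and `L` of degree `p`)
are `U, A, R, C`:
* `(U_K : N_{N/K}(U_N)) = p ^ U`,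
* `A` is the dimension of the space `𝓟_{L/ℚ} / 𝓟_ℚ` of absolute principal factors,
* `R` is the dimension of the space of relative principal factors,
* `C` is the dimension of the capitulation kernel `ker(T_{N/K})`. -/
structure HasInvariants (p : ℕ) (K L N : Type*) [Field K] [NumberField K] [Field L]
    [NumberField L] [Field N] [NumberField N] [Algebra K N] [Algebra L N] (U A R C : ℕ) :
    Prop where
  unit_index : (unitNorm K N).range.index = p ^ U
  absolute : HasFpDim p (PrincipalFactors ℚ L p) A
  relative : HasFpDim p (relativePrincipalFactors K L N p) R
  capitulation : HasFpDim p (transfer K N).ker C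

/-- `N` is of type `T`: for the quadratic subfield `K` and every subfield `L` of degree `p`
(these `L` are conjugate), the invariants `U, A, R, C` are those in the row `T` of the table. -/
def IsOfType (p : ℕ) (N : Type*) [Field N] [NumberField N] (T : DPFType) : Prop :=
  ∀ K L : IntermediateField ℚ N, Module.finrank ℚ K = 2 → Module.finrank ℚ L = p →
    HasInvariants p K L N T.U T.A T.R T.C

end DPF

end

/-!
Let `σ` generate `Gal(N/K)`, write `U_N`, `U_K` for the unit groups and `𝓟_{N/K}` for the ambiguous
principal ideals of `N/K`. The theorem is a computation of the order of `𝓟_{N/K} / 𝓟_K` in two ways.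

By Hilbert's Theorem 90 (`exists_mul_conj_eq_of_prod_eq_one`), `(x) ↦ x / σ x` identifies
`𝓟_{N/K} / 𝓟_K` with `ker(N_{N/K} | U_N) / U_N ^ (1 - σ)`. The Herbrand quotient of a finitely
generated `ℤ[σ]`-module without `p`-torsion depends only on the ranks of the module and of its fixed
points (`relIndex_range_mul_index`): on the kernel of the norm, which is a module over `ℤ[ζ_p]`, the
index of the image of `1 - σ` follows from the factorization of `p` into factors associated to
`1 - ζ_p`. For units of totally real fields the ranks are known from Dirichlet's unit theorem, and
they give `#(𝓟_{N/K} / 𝓟_K) = p * (U_K : N U_N)`, with `(U_K : N U_N)` a divisor of `p`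
(`relIndex_units_eq`, `relIndex_ambiguousPrincipalIdeals`). So this order is `p ^ (U + 1)` with
`U ≤ 1`.

On the other hand `(𝓟_{N/K} ∩ 𝓘_K) / 𝓟_K` is the capitulation kernel (`card_ker_transfer`), and the
remaining quotient `V = 𝓟_{N/K} 𝓘_K / 𝓘_K` is mapped by the norm `N_{N/L}` onto `𝓟_{L/ℚ} / 𝓟_ℚ`:
extension of ideals from `L` to `N` followed by the norm is squaring, which is bijective on a group
of odd exponent `p` (`map_idealNorm_sup_eq`). The kernel of the norm on `V` consists of the relative
principal factors. Hence `U + 1 = A + R + C` (`card_mul_card_mul_card`, `exists_hasInvariants`).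

The quadratic subfield `K` is unique. The relative principal factors are the same for every `L`,
because an ambiguous ideal `I` lies in the kernel of `N_{N/L}` modulo ideals of `ℚ` exactly when
`I * τ I` comes from `K`, where `τ` generates `Gal(N/L)`; the involutions `τ` belonging to different
`L` differ by elements of `Gal(N/K)`, which fix ambiguous principal ideals
(`relativePrincipalFactors_le`). Thus `U`, `R`, `C`, and with them `A`, do not depend on `L`.

Identities between homomorphisms on fractional ideals, such as base change for norms, are reduced to
principal ideals: the class number is finite and the groups of fractional ideals are torsion-free
(`fracIdeals_hom_ext`).
-/

namespace DPF

/-! ### The Herbrand quotient of a finitely generated module -/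

section Herbrand

open Module Polynomial

variable {M : Type*} [AddCommGroup M]

/-- Torsion prime to `n` does not change the index of `n • M`, so the formula for free modules
persists. -/
lemma index_range_nsmul_of_injective [Module.Finite ℤ M] (n : ℕ)
    (hn : ∀ m : M, n • m = 0 → m = 0) :
    (nsmulAddMonoidHom (α := M) n).range.index = n ^ finrank ℤ M := by
  set T := Submodule.torsion ℤ M
  have hT : Finite T := Module.finite_of_fg_torsion T (Submodule.torsion_isTorsion)
  have hfree : Module.Free ℤ (M ⧸ T) := inferInstance
  have key := AddSubgroup.index_range_nsmul (M ⧸ T) n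
  rw [show finrank ℤ (M ⧸ T) = finrank ℤ M by
    have := finrank_quotient_torsion_eq (M := M)
    rwa [← Submodule.torsion_int] at this] at key
  rw [← key]
  let q : M →+ M ⧸ T := T.mkQ.toAddMonoidHom
  have hq : Function.Surjective q := T.mkQ_surjective
  rw [← AddSubgroup.index_comap_of_surjective _ hq]
  congr 1
  have hsurj : Function.Surjective (fun t : T => n • t) := by
    apply Finite.surjective_of_injective
    intro a b hab
    have : n • ((a - b : T) : M) = 0 := by
      have := congr_arg (Subtype.val) hab
      simp only [Submodule.coe_smul_of_tower] at this
      simp [smul_sub, this]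
    exact sub_eq_zero.mp (Subtype.ext (hn _ this))
  ext m
  simp only [AddMonoidHom.mem_range, AddSubgroup.mem_comap, nsmulAddMonoidHom_apply]
  constructor
  · rintro ⟨x, rfl⟩
    exact ⟨q x, (map_nsmul q n x).symm⟩
  · rintro ⟨y, hy⟩
    obtain ⟨x, rfl⟩ := hq y
    have h1 : m - n • x ∈ T := by
      rw [← Submodule.Quotient.eq]
      exact (hy.symm.trans (map_nsmul q n x).symm)
    obtain ⟨t, ht⟩ := hsurj ⟨_, h1⟩
    refine ⟨x + t, ?_⟩
    have := congr_arg Subtype.val ht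
    simp only [Submodule.coe_smul_of_tower] at this
    rw [smul_add, this]; abel

/-- Multiplicativity of the index of the range of an injective endomorphism. -/
lemma index_range_mul (f g : Module.End ℤ M) (hf : Function.Injective f) :
    (f * g).toAddMonoidHom.range.index =
      g.toAddMonoidHom.range.index * f.toAddMonoidHom.range.index := by
  rw [← AddSubgroup.index_map_of_injective (f := f.toAddMonoidHom) _ hf, AddMonoidHom.map_range]
  rfl

lemma index_range_pow (f : Module.End ℤ M) (hf : Function.Injective f) (k : ℕ) :
    (f ^ k).toAddMonoidHom.range.index = f.toAddMonoidHom.range.index ^ k := by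
  induction k with
  | zero =>
    rw [pow_zero, pow_zero, AddSubgroup.index_eq_one, AddMonoidHom.range_eq_top]
    exact fun x => ⟨x, rfl⟩
  | succ k ih => rw [pow_succ', index_range_mul _ _ hf, ih, pow_succ]

/-- The identity `∏ (1 - ζ_p ^ k) = p`, lifted from `ℤ[ζ_p]` to a congruence in `ℤ[X]` modulo the
`p`-th cyclotomic polynomial `1 + X + ⋯ + X ^ (p - 1)`. -/
lemma exists_prod_one_sub_pow_eq (p : ℕ) [hp : Fact p.Prime] :
    ∃ q : ℤ[X], ∏ k ∈ Finset.range (p - 1), (1 - X ^ (k + 1) : ℤ[X]) =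
      (p : ℤ[X]) + (∑ i ∈ Finset.range p, X ^ i) * q := by
  have hζ := Complex.isPrimitiveRoot_exp p hp.out.ne_zero
  set ζ := Complex.exp (2 * Real.pi * Complex.I / p)
  have hp1 : p - 1 + 1 = p := Nat.succ_pred_prime hp.out
  have h1 : aeval ζ (∏ k ∈ Finset.range (p - 1), (1 - X ^ (k + 1) : ℤ[X]) - (p : ℤ[X])) = 0 := by
    have := IsPrimitiveRoot.prod_one_sub_pow_eq_order (n := p - 1) (μ := ζ) (by rwa [hp1])
    simp only [map_sub, map_prod, map_one, map_pow, aeval_X, this, map_natCast]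
    rw [← Nat.cast_add_one, hp1, sub_self]
  have h2 := minpoly.isIntegrallyClosed_dvd (hζ.isIntegral hp.out.pos) h1
  rw [← cyclotomic_eq_minpoly hζ hp.out.pos, cyclotomic_prime] at h2
  obtain ⟨q, hq⟩ := h2
  exact ⟨q, by rw [← hq]; ring⟩

/-- On a finitely generated group without `p`-torsion on which `1 + σ + ⋯ + σ ^ (p - 1) = 0`,
i.e. a module over `ℤ[ζ_p]`, the factorization `p = ∏ (1 - ζ_p ^ k)`, whose factors are all
associated to `1 - ζ_p`, determines the index of the image of `1 - σ`. -/
lemma index_range_one_sub_pow [Module.Finite ℤ M] (p : ℕ) [hp : Fact p.Prime]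
    (htors : ∀ m : M, p • m = 0 → m = 0) (σ : Module.End ℤ M)
    (hσ : ∑ i ∈ Finset.range p, σ ^ i = 0) :
    (1 - σ).toAddMonoidHom.range.index ^ (p - 1) = p ^ finrank ℤ M := by
  obtain ⟨q, hq⟩ := exists_prod_one_sub_pow_eq p
  have hσp : σ ^ p = 1 := by
    have := mul_neg_geom_sum σ p
    rw [hσ, mul_zero] at this
    exact (sub_eq_zero.mp this.symm).symm
  have hprod : aeval σ (∏ k ∈ Finset.range (p - 1), (1 - X ^ (k + 1) : ℤ[X])) =
      (p : Module.End ℤ M) := by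
    rw [hq]
    simp [hσ]
  have hinj_p : Function.Injective (p : Module.End ℤ M) := by
    rw [injective_iff_map_eq_zero]
    intro m hm
    exact htors m (by simpa using hm)
  -- `1 - σ` divides `p`, so it is injective
  have hinj : Function.Injective (1 - σ : Module.End ℤ M) := by
    have h0 : (1 - X : ℤ[X]) ∣ ∏ k ∈ Finset.range (p - 1), (1 - X ^ (k + 1) : ℤ[X]) := by
      have := Finset.dvd_prod_of_mem (fun k => (1 - X ^ (k + 1) : ℤ[X]))
        (Finset.mem_range.mpr (show 0 < p - 1 by have := hp.out.two_le; omega))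
      simpa using this
    obtain ⟨r, hr⟩ := h0
    rw [hr, mul_comm, map_mul] at hprod
    have : Function.Injective (aeval σ r * (1 - σ) : Module.End ℤ M) := by
      have h2 : aeval σ (1 - X : ℤ[X]) = 1 - σ := by simp
      rw [← h2, hprod]; exact hinj_p
    exact Function.Injective.of_comp (f := (aeval σ r : Module.End ℤ M)) this
  -- the quotient of `1 - σ ^ (k + 1)` by `1 - σ` is a unit
  have hunit : ∀ k ∈ Finset.range (p - 1),
      IsUnit (aeval σ (∑ i ∈ Finset.range (k + 1), X ^ i : ℤ[X])) := by
    intro k hk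
    rw [Finset.mem_range] at hk
    have hcop : Nat.Coprime (k + 1) p := by
      refine Nat.Coprime.symm ((Nat.Prime.coprime_iff_not_dvd hp.out).mpr fun h => ?_)
      have := Nat.le_of_dvd (by omega) h
      omega
    obtain ⟨j, -, hj⟩ := Nat.exists_mul_mod_eq_one_of_coprime hcop hp.out.one_lt
    have hσj : (σ ^ (k + 1)) ^ j = σ := by
      rw [← pow_mul, ← Nat.div_add_mod ((k + 1) * j) p, hj, pow_add, pow_mul, hσp, one_pow,
        one_mul, pow_one]
    set v := ∑ i ∈ Finset.range (k + 1), σ ^ i with hv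
    set w := ∑ i ∈ Finset.range j, (σ ^ (k + 1)) ^ i with hw
    have h1 : (1 - σ) * v = 1 - σ ^ (k + 1) := mul_neg_geom_sum σ (k + 1)
    have h2 : (1 - σ ^ (k + 1)) * w = 1 - σ := by rw [hw, mul_neg_geom_sum, hσj]
    have h3 : v * w = 1 := by
      ext m
      apply hinj
      rw [← Module.End.mul_apply, ← Module.End.mul_apply, ← mul_assoc, h1, h2, mul_one]
    have hcomm : Commute v w := by
      refine Commute.sum_left _ _ _ fun i _ => Commute.sum_right _ _ _ fun l _ => ?_
      rw [← pow_mul]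
      exact (Commute.refl σ).pow_pow _ _
    have : aeval σ (∑ i ∈ Finset.range (k + 1), X ^ i : ℤ[X]) = v := by simp [hv]
    rw [this]
    exact ⟨⟨v, w, h3, hcomm.eq.symm.trans h3⟩, rfl⟩
  have hfac : ∏ k ∈ Finset.range (p - 1), (1 - X ^ (k + 1) : ℤ[X]) =
      (1 - X) ^ (p - 1) *
        ∏ k ∈ Finset.range (p - 1), ∑ i ∈ Finset.range (k + 1), (X ^ i : ℤ[X]) := by
    rw [← Finset.card_range (p - 1), ← Finset.prod_const, Finset.card_range,
      ← Finset.prod_mul_distrib]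
    exact Finset.prod_congr rfl fun k _ => (mul_neg_geom_sum _ _).symm
  set u := aeval σ (∏ k ∈ Finset.range (p - 1), ∑ i ∈ Finset.range (k + 1), (X ^ i : ℤ[X])) with hu
  have huu : IsUnit u := by
    rw [hu]
    exact Finset.prod_induction _ (fun f : ℤ[X] => IsUnit (aeval σ f))
      (fun a b ha hb => by rw [map_mul]; exact ha.mul hb) (by simp) hunit
  have hp_eq : (p : Module.End ℤ M) = (1 - σ) ^ (p - 1) * u := by
    rw [← hprod, hfac, map_mul, ← hu]; simp
  have hinjk : Function.Injective ((1 - σ) ^ (p - 1) : Module.End ℤ M) := by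
    rw [Module.End.coe_pow]; exact hinj.iterate _
  have hrange_u : u.toAddMonoidHom.range.index = 1 := by
    rw [AddSubgroup.index_eq_one, AddMonoidHom.range_eq_top]
    exact ((Module.End.isUnit_iff _).mp huu).2
  have hmul := index_range_mul _ u hinjk
  rw [hrange_u, one_mul, ← hp_eq, index_range_pow _ hinj] at hmul
  rw [← index_range_nsmul_of_injective p htors, ← hmul]
  congr 2

lemma geom_sum_apply_of_mem_ker (n : ℕ) (σ : Module.End ℤ M) (m : M)
    (hm : m ∈ LinearMap.ker (1 - σ)) : (∑ i ∈ Finset.range n, σ ^ i) m = n • m := by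
  rw [LinearMap.mem_ker, LinearMap.sub_apply, Module.End.one_apply, sub_eq_zero] at hm
  have hpow : ∀ i : ℕ, (σ ^ i) m = m := by
    intro i
    induction i with
    | zero => simp
    | succ i ih => rw [pow_succ, Module.End.mul_apply, ← hm, ih]
  simp [hpow]

/-- The index formula behind the Herbrand quotient of a finitely generated module without
`p`-torsion over a cyclic group `⟨σ⟩` of order `p`: both Tate cohomology groups are measured
against the index of `ker (∑ σ ^ i) + ker (1 - σ)`. -/
lemma relIndex_range_mul_index [Module.Finite ℤ M] (p : ℕ) [hp : Fact p.Prime]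
    (htors : ∀ m : M, p • m = 0 → m = 0) (σ : Module.End ℤ M) (hσ : σ ^ p = 1)
    (D Nm : Module.End ℤ M) (hD : D = 1 - σ) (hNm : Nm = ∑ i ∈ Finset.range p, σ ^ i) (s : ℕ)
    (hs : finrank ℤ (LinearMap.ker Nm) = s * (p - 1)) :
    D.toAddMonoidHom.range.relIndex Nm.toAddMonoidHom.ker *
        (Nm.toAddMonoidHom.ker ⊔ D.toAddMonoidHom.ker).index = p ^ s ∧
      Nm.toAddMonoidHom.range.relIndex D.toAddMonoidHom.ker *
        (Nm.toAddMonoidHom.ker ⊔ D.toAddMonoidHom.ker).index =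
        p ^ finrank ℤ (LinearMap.ker D) := by
  have hND : Nm * D = 0 := by rw [hNm, hD, geom_sum_mul_neg, hσ, sub_self]
  have hDN : D * Nm = 0 := by rw [hNm, hD, mul_neg_geom_sum, hσ, sub_self]
  have hfix : ∀ m ∈ LinearMap.ker D, Nm m = p • m := by
    subst hD hNm
    exact geom_sum_apply_of_mem_ker p σ
  constructor
  · have h1 : (Nm.toAddMonoidHom.ker.map D.toAddMonoidHom).relIndex D.toAddMonoidHom.range =
        (Nm.toAddMonoidHom.ker ⊔ D.toAddMonoidHom.ker).index := by
      rw [AddMonoidHom.range_eq_map, AddSubgroup.relIndex_map_map, top_sup_eq,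
        AddSubgroup.relIndex_top_right]
    have hle : D.toAddMonoidHom.range ≤ Nm.toAddMonoidHom.ker := by
      rintro _ ⟨x, rfl⟩
      exact LinearMap.congr_fun hND x
    rw [mul_comm, ← h1, AddSubgroup.relIndex_mul_relIndex _ _ _ (AddSubgroup.map_le_range _ _) hle]
    have hmaps : ∀ x ∈ LinearMap.ker Nm, σ x ∈ LinearMap.ker Nm := by
      intro x hx
      have hc : Nm * σ = σ * Nm := by
        rw [hNm, Finset.sum_mul, Finset.mul_sum]
        exact Finset.sum_congr rfl fun i _ => ((Commute.refl σ).pow_left i).eq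
      rw [LinearMap.mem_ker] at hx ⊢
      rw [← Module.End.mul_apply, hc, Module.End.mul_apply, hx, map_zero]
    set τ : Module.End ℤ (LinearMap.ker Nm) := σ.restrict hmaps with hτ
    have hτi : ∀ (i : ℕ) (x : LinearMap.ker Nm), ((τ ^ i) x : M) = (σ ^ i) x := by
      intro i
      induction i with
      | zero => simp
      | succ i ih => intro x; rw [pow_succ, pow_succ, Module.End.mul_apply, ih]; rfl
    have key := index_range_one_sub_pow (M := LinearMap.ker Nm) p
      (fun m hm => Subtype.ext (htors m (by simpa using congr_arg Subtype.val hm))) τ (by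
        ext x
        have h := LinearMap.mem_ker.mp x.2
        have h' := LinearMap.congr_fun hNm (x : M)
        rw [h] at h'
        simpa [hτi] using h'.symm)
    rw [hs, pow_mul] at key
    refine (Nat.pow_left_injective (n := p - 1) (by have := hp.out.two_le; omega)) (.trans ?_ key)
    refine congr_arg (· ^ (p - 1)) ?_
    refine congr_arg AddSubgroup.index ?_
    ext x
    constructor
    · rintro ⟨y, hy, hyx⟩
      refine ⟨⟨y, hy⟩, Subtype.ext (.trans ?_ hyx)⟩
      rw [hD]; rfl
    · rintro ⟨y, rfl⟩
      refine ⟨y, y.2, ?_⟩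
      rw [hD]; rfl
  · have h1 : (D.toAddMonoidHom.ker.map Nm.toAddMonoidHom).relIndex Nm.toAddMonoidHom.range =
        (Nm.toAddMonoidHom.ker ⊔ D.toAddMonoidHom.ker).index := by
      rw [AddMonoidHom.range_eq_map, AddSubgroup.relIndex_map_map, top_sup_eq,
        AddSubgroup.relIndex_top_right, sup_comm]
    have hle : Nm.toAddMonoidHom.range ≤ D.toAddMonoidHom.ker := by
      rintro _ ⟨x, rfl⟩
      exact LinearMap.congr_fun hDN x
    rw [mul_comm, ← h1, AddSubgroup.relIndex_mul_relIndex _ _ _ (AddSubgroup.map_le_range _ _) hle]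
    rw [← index_range_nsmul_of_injective (M := LinearMap.ker D) p
      (fun m hm => Subtype.ext (htors m (by simpa using congr_arg Subtype.val hm)))]
    refine congr_arg AddSubgroup.index ?_
    ext x
    constructor
    · rintro ⟨y, hy, hyx⟩
      exact ⟨⟨y, hy⟩, Subtype.ext (.trans (hfix y hy).symm hyx)⟩
    · rintro ⟨y, rfl⟩
      exact ⟨y, y.2, hfix y y.2⟩

/-- The kernel of the norm has complementary rank to the fixed points. -/
lemma finrank_ker_add_finrank_fixed [Module.Finite ℤ M] (p : ℕ)
    (htors : ∀ m : M, p • m = 0 → m = 0) (σ : Module.End ℤ M) (hσ : σ ^ p = 1)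
    (D Nm : Module.End ℤ M) (hD : D = 1 - σ) (hNm : Nm = ∑ i ∈ Finset.range p, σ ^ i) :
    finrank ℤ (LinearMap.ker Nm) + finrank ℤ (LinearMap.ker D) = finrank ℤ M := by
  have hDN : D * Nm = 0 := by rw [hNm, hD, mul_neg_geom_sum, hσ, sub_self]
  have hfix : ∀ m ∈ LinearMap.ker D, Nm m = p • m := by
    subst hD hNm
    exact geom_sum_apply_of_mem_ker p σ
  have h1 : finrank ℤ (LinearMap.range Nm) = finrank ℤ (LinearMap.ker D) := by
    apply le_antisymm
    · apply Submodule.finrank_mono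
      rintro _ ⟨x, rfl⟩
      exact LinearMap.congr_fun hDN x
    · let f : LinearMap.ker D →ₗ[ℤ] LinearMap.range Nm :=
        Nm.rangeRestrict ∘ₗ (LinearMap.ker D).subtype
      apply LinearMap.finrank_le_finrank_of_injective (f := f)
      rw [injective_iff_map_eq_zero]
      intro m hm
      refine Subtype.ext (htors m ?_)
      rw [← hfix m m.2]
      exact congr_arg Subtype.val hm
  rw [← h1, add_comm, ← (Nm.quotKerEquivRange).finrank_eq, Submodule.finrank_quotient_add_finrank]

end Herbrand

/-! ### Fractional ideals of number fields -/

section Ideals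

variable (E : Type*) [Field E] [NumberField E]

/-- The principal fractional ideal generated by a nonzero element. -/
abbrev prin : Eˣ →* FracIdeals E := toPrincipalIdeal (𝓞 E) E

variable {E}

/-- The group of fractional ideals is torsion-free, by unique factorization of the integral ideals
`I.num` and `(I.den)`. -/
lemma fracIdeals_eq_one_of_pow_eq_one {I : FracIdeals E} {n : ℕ} (hn : n ≠ 0) (h : I ^ n = 1) :
    I = 1 := by
  have h1 : ((I : FractionalIdeal (𝓞 E)⁰ E)) ^ n = 1 := by
    rw [← Units.val_pow_eq_pow_val, h, Units.val_one]
  set d : 𝓞 E := ((I : FractionalIdeal (𝓞 E)⁰ E).den : 𝓞 E) with hd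
  set J : Ideal (𝓞 E) := (I : FractionalIdeal (𝓞 E)⁰ E).num with hJ
  have hdJ : (Ideal.span {d} : Ideal (𝓞 E)) * (I : FractionalIdeal (𝓞 E)⁰ E) = J := by
    rw [FractionalIdeal.coeIdeal_span_singleton]
    exact FractionalIdeal.den_mul_self_eq_num' _ _ _
  have h2 : J ^ n = Ideal.span {d} ^ n := by
    apply FractionalIdeal.coeIdeal_injective (K := E)
    simp only [FractionalIdeal.coeIdeal_pow]
    rw [← hdJ, mul_pow, h1, mul_one]
  have h3 : J = Ideal.span {d} := pow_left_injective hn h2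
  rw [h3] at hdJ
  have hne : ((Ideal.span {d} : Ideal (𝓞 E)) : FractionalIdeal (𝓞 E)⁰ E) ≠ 0 := by
    rw [Ne, FractionalIdeal.coeIdeal_eq_zero, Ideal.span_singleton_eq_bot]
    exact nonZeroDivisors.coe_ne_zero _
  exact Units.ext (mul_left_cancel₀ hne (hdJ.trans (mul_one _).symm))

instance : IsMulTorsionFree (FracIdeals E) where
  pow_left_injective n hn a b hab := by
    rw [← div_eq_one]
    refine fracIdeals_eq_one_of_pow_eq_one hn ?_
    rw [div_pow, div_eq_one]
    exact hab

lemma prin_eq_one_iff {x : Eˣ} :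
    prin E x = 1 ↔ ∃ u : (𝓞 E)ˣ, Units.map (algebraMap (𝓞 E) E : 𝓞 E →* E) u = x := by
  constructor
  · intro h
    have hint : ∀ y : Eˣ, prin E y = 1 → ∃ a : 𝓞 E, algebraMap (𝓞 E) E a = y := by
      intro y hy
      rw [toPrincipalIdeal_eq_iff, Units.val_one] at hy
      rw [← FractionalIdeal.mem_one_iff (S := (𝓞 E)⁰), ← hy]
      exact FractionalIdeal.mem_spanSingleton_self _ _
    obtain ⟨a, ha⟩ := hint x h
    obtain ⟨b, hb⟩ := hint x⁻¹ (by rw [map_inv, h, inv_one])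
    have hab : a * b = 1 := by
      apply FaithfulSMul.algebraMap_injective (𝓞 E) E
      rw [map_mul, ha, hb, map_one, Units.mul_inv]
    exact ⟨⟨a, b, hab, by rw [mul_comm, hab]⟩, Units.ext ha⟩
  · rintro ⟨u, rfl⟩
    rw [toPrincipalIdeal_eq_iff, Units.val_one]
    apply le_antisymm
    · rw [FractionalIdeal.spanSingleton_le_iff_mem, FractionalIdeal.mem_one_iff]
      exact ⟨u, rfl⟩
    · rw [FractionalIdeal.one_le, FractionalIdeal.mem_spanSingleton]
      refine ⟨((u⁻¹ : (𝓞 E)ˣ) : 𝓞 E), ?_⟩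
      rw [Algebra.smul_def]
      change algebraMap (𝓞 E) E _ * algebraMap (𝓞 E) E u = 1
      rw [← map_mul, Units.inv_mul, map_one]

variable (E) in
/-- Finiteness of the class number: a fixed power of every fractional ideal is principal. -/
lemma exists_pow_mem_principal : ∃ h : ℕ, h ≠ 0 ∧ ∀ I : FracIdeals E, ∃ x, prin E x = I ^ h := by
  refine ⟨Fintype.card (ClassGroup (𝓞 E)), Fintype.card_ne_zero, fun I => ?_⟩
  have h1 : ClassGroup.mk E (I ^ Fintype.card (ClassGroup (𝓞 E))) = 1 := by
    rw [map_pow, pow_card_eq_one]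
  rw [ClassGroup.mk_eq_one_iff, FractionalIdeal.isPrincipal_iff] at h1
  obtain ⟨x, hx⟩ := h1
  exact mem_principal_ideals_iff.mpr ⟨x, hx.symm⟩

/-- Homomorphisms from fractional ideals to a torsion-free group are determined by their values on
principal ideals, because the class number is finite. -/
lemma fracIdeals_hom_ext {H : Type*} [CommGroup H] [IsMulTorsionFree H] {f g : FracIdeals E →* H}
    (hfg : ∀ x, f (prin E x) = g (prin E x)) : f = g := by
  obtain ⟨h, h0, hh⟩ := exists_pow_mem_principal E
  ext I
  obtain ⟨x, hx⟩ := hh I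
  apply pow_left_injective h0
  change f I ^ h = g I ^ h
  rw [← map_pow, ← map_pow, ← hx, hfg]

variable (F : Type*) [Field F] [NumberField F] [Algebra F E]

lemma extendIdeal_prin (x : Fˣ) :
    extendIdeal F E (prin F x) = prin E (Units.map (algebraMap F E : F →* E) x) := by
  rw [eq_comm, toPrincipalIdeal_eq_iff]
  change _ = FractionalIdeal.extendedHom E (𝓞 E) (prin F x : FractionalIdeal (𝓞 F)⁰ F)
  rw [coe_toPrincipalIdeal, FractionalIdeal.extendedHom_spanSingleton]
  refine congr_arg _ ?_
  exact congr_fun (congr_arg DFunLike.coe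
    (IsLocalization.algebraMap_eq_map_map_submonoid (𝓞 F)⁰ (𝓞 E) F E)) _

lemma extendIdeal_injective : Function.Injective (extendIdeal F E) := by
  intro I J h
  have := congr_arg Units.val h
  exact Units.ext (FractionalIdeal.extendedHom_injective (𝓞 F) F E (𝓞 E) this)

/-- The norm of a principal ideal is generated by the norm of a generator. -/
lemma idealNorm_prin (x : Eˣ) :
    idealNorm F E (prin E x) = prin F (Units.map (Algebra.norm F : E →* F) x) := by
  have hint : ∀ (a : 𝓞 E) (y : Eˣ), algebraMap (𝓞 E) E a = y →
      idealNorm F E (prin E y) = prin F (Units.map (Algebra.norm F : E →* F) y) := by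
    intro a y hay
    apply Units.ext
    change fracRelNorm F E (prin E y : FractionalIdeal (𝓞 E)⁰ E) = _
    rw [coe_toPrincipalIdeal, coe_toPrincipalIdeal, ← hay,
      ← FractionalIdeal.coeIdeal_span_singleton, fracRelNorm_coeIdeal, Ideal.relNorm_singleton,
      FractionalIdeal.coeIdeal_span_singleton, Algebra.algebraMap_intNorm (L := E) (K := F), hay]
    rfl
  obtain ⟨a, b, hb, hab⟩ := IsFractionRing.div_surjective (A := 𝓞 E) (x : E)
  have hb0 : algebraMap (𝓞 E) E b ≠ 0 := by
    rw [Ne, FaithfulSMul.algebraMap_eq_zero_iff]; exact nonZeroDivisors.ne_zero hb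
  have ha0 : algebraMap (𝓞 E) E a ≠ 0 := by
    intro h; rw [h, zero_div] at hab; exact x.ne_zero hab.symm
  have hx : x = Units.mk0 _ ha0 / Units.mk0 _ hb0 := Units.ext (by simp [hab])
  rw [hx, map_div, map_div, map_div, map_div, hint a _ rfl, hint b _ rfl]

lemma idealNorm_extendIdeal (I : FracIdeals F) :
    idealNorm F E (extendIdeal F E I) = I ^ Module.finrank F E := by
  have : (idealNorm F E).comp (extendIdeal F E) = powMonoidHom (Module.finrank F E) := by
    refine fracIdeals_hom_ext fun x => ?_
    rw [MonoidHom.comp_apply, extendIdeal_prin, idealNorm_prin, powMonoidHom_apply, ← map_pow]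
    congr 1
    ext
    simp [Algebra.norm_algebraMap]
  exact DFunLike.congr_fun this I

lemma principalIdeals_rat : principalIdeals ℚ = ⊤ := by
  rw [eq_top_iff]
  intro I _
  have : IsPrincipalIdealRing (𝓞 ℚ) :=
    IsPrincipalIdealRing.of_surjective Rat.ringOfIntegersEquiv.symm
      Rat.ringOfIntegersEquiv.symm.surjective
  exact mem_principal_ideals_iff.mpr
    (by
      obtain ⟨x, hx⟩ := (FractionalIdeal.isPrincipal_iff (I : FractionalIdeal (𝓞 ℚ)⁰ ℚ)).mp
        inferInstance
      exact ⟨x, hx.symm⟩)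

lemma basePrincipalIdeals_rat : basePrincipalIdeals ℚ E = baseIdeals ℚ E := by
  rw [basePrincipalIdeals, principalIdeals_rat, baseIdeals, MonoidHom.range_eq_map]

lemma baseIdeals_le_ambiguousIdeals (p : ℕ) : baseIdeals F E ≤ ambiguousIdeals F E p := by
  rintro _ ⟨J, rfl⟩
  exact ⟨J ^ p, map_pow _ _ _⟩

lemma basePrincipalIdeals_le_baseIdeals : basePrincipalIdeals F E ≤ baseIdeals F E := by
  rintro _ ⟨J, _, rfl⟩
  exact ⟨J, rfl⟩

lemma basePrincipalIdeals_le_ambiguousPrincipalIdeals (p : ℕ) :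
    basePrincipalIdeals F E ≤ ambiguousPrincipalIdeals F E p := by
  refine le_inf ((basePrincipalIdeals_le_baseIdeals F).trans (baseIdeals_le_ambiguousIdeals F p)) ?_
  rintro _ ⟨_, ⟨x, rfl⟩, rfl⟩
  exact ⟨_, (extendIdeal_prin F x).symm⟩

end Ideals

/-! ### Cyclic actions on multiplicative groups -/

section Herbrand

open Module

variable {G : Type*} [CommGroup G]

/-- Multiplicative form of the Herbrand quotient computation, for an automorphism `σ` with
`σ ^ p = 1` of a finitely generated abelian group of rank `2 * p - 1` whose fixed group `D.ker` has
rank `1`. The kernel of the norm then has rank `2 * (p - 1)`, so that the two Tate cohomology groups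
have orders `p ^ 2 / k` and `p / k` for the same index `k`. -/
lemma relIndex_ker_norm_eq [Module.Finite ℤ (Additive G)] (p : ℕ) [hp : Fact p.Prime]
    (htors : ∀ g : G, g ^ p = 1 → g = 1) (σ D Nm : G →* G) (hσ : ∀ g, σ^[p] g = g)
    (hD : ∀ g, D g = g / σ g) (hNm : ∀ g, Nm g = ∏ i ∈ Finset.range p, σ^[i] g)
    (hG : finrank ℤ (Additive G) = 2 * p - 1) (hfix : finrank ℤ (Additive D.ker) = 1) :
    D.range.relIndex Nm.ker = p * Nm.range.relIndex D.ker ∧ Nm.range.relIndex D.ker ∣ p := by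
  set σ' : Module.End ℤ (Additive G) := (MonoidHom.toAdditive σ).toIntLinearMap with hσ'
  set D' : Module.End ℤ (Additive G) := (MonoidHom.toAdditive D).toIntLinearMap with hD'
  set Nm' : Module.End ℤ (Additive G) := (MonoidHom.toAdditive Nm).toIntLinearMap with hNm'
  have hpow : ∀ (i : ℕ) (g : Additive G), (σ' ^ i) g = Additive.ofMul (σ^[i] g.toMul) := by
    intro i g
    rw [Module.End.coe_pow]
    induction i with
    | zero => rfl
    | succ i ih => rw [Function.iterate_succ_apply', ih, Function.iterate_succ_apply']; rfl
  have e1 : σ' ^ p = 1 := by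
    ext g; rw [hpow, hσ]; rfl
  have e2 : D' = 1 - σ' := by
    ext g; exact congr_arg Additive.ofMul (hD g.toMul)
  have e3 : Nm' = ∑ i ∈ Finset.range p, σ' ^ i := by
    ext g
    rw [LinearMap.sum_apply]
    simp only [hpow]
    rw [← ofMul_prod, ← hNm]; rfl
  have htors' : ∀ m : Additive G, p • m = 0 → m = 0 := fun m hm => htors m.toMul hm
  have hk : finrank ℤ (LinearMap.ker D') = 1 := by
    rw [← hfix]
    exact LinearEquiv.finrank_eq (AddEquiv.toIntLinearEquiv
      { toFun := fun x => ⟨x.1, x.2⟩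
        invFun := fun x => ⟨x.1, x.2⟩
        left_inv := fun _ => rfl
        right_inv := fun _ => rfl
        map_add' := fun _ _ => rfl })
  have hr := finrank_ker_add_finrank_fixed p htors' σ' e1 D' Nm' e2 e3
  have hp2 := hp.out.two_le
  obtain ⟨h1, h2⟩ := relIndex_range_mul_index p htors' σ' e1 D' Nm' e2 e3 2 (by omega)
  rw [hk, pow_one] at h2
  have c1 : D.range.relIndex Nm.ker =
    D'.toAddMonoidHom.range.relIndex Nm'.toAddMonoidHom.ker := rfl
  have c2 : Nm.range.relIndex D.ker =
    Nm'.toAddMonoidHom.range.relIndex D'.toAddMonoidHom.ker := rfl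
  rw [c1, c2]
  refine ⟨?_, Dvd.intro _ h2⟩
  set k := (Nm'.toAddMonoidHom.ker ⊔ D'.toAddMonoidHom.ker).index
  have hk0 : k ≠ 0 := by
    intro h; rw [h, mul_zero] at h2; omega
  refine Nat.eq_of_mul_eq_mul_right (Nat.pos_of_ne_zero hk0) ?_
  rw [h1, mul_assoc, h2, sq]

end Herbrand

section Hilbert90

/-- Hilbert's Theorem 90 for a cyclic group `⟨g⟩`, proved with the Lagrange resolvent. Mathlib's
`groupCohomology.exists_div_of_norm_eq_one` is restricted to fields in `Type`. -/
lemma exists_mul_conj_eq_of_prod_eq_one {K N : Type*} [Field K] [Field N] [Algebra K N]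
    (g : N ≃ₐ[K] N) {n : ℕ} (hg : orderOf g = n) (hn : n ≠ 0) (x : N)
    (hx : ∏ i ∈ Finset.range n, (g ^ i) x = 1) : ∃ y : N, y ≠ 0 ∧ x * g y = y := by
  -- a nonvanishing resolvent `∑ f i * (g ^ i) z` exists by independence of characters
  set f : ℕ → N := fun i => ∏ j ∈ Finset.range i, (g ^ j) x with hf
  have hli := linearIndependent_monoidHom N N
  let φ : Fin n → (N →* N) := fun i => ((g ^ (i : ℕ) : N ≃ₐ[K] N) : N →* N)
  have hφ : Function.Injective φ := by
    intro i j hij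
    refine Fin.ext (pow_injOn_Iio_orderOf (x := g) (hg ▸ i.2) (hg ▸ j.2)
      (?_ : g ^ (i : ℕ) = g ^ (j : ℕ)))
    ext z
    exact DFunLike.congr_fun hij z
  have hli2 := hli.comp φ hφ
  rw [Fintype.linearIndependent_iff] at hli2
  have hex : ∃ z : N, ∑ i ∈ Finset.range n, f i * (g ^ i) z ≠ 0 := by
    by_contra! hcon
    have := hli2 (fun i => f i) (by
      ext z
      have := hcon z
      rw [Finset.sum_range] at this
      simpa [φ] using this) ⟨0, Nat.pos_of_ne_zero hn⟩
    simp [hf] at this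
  obtain ⟨z, hz⟩ := hex
  refine ⟨_, hz, ?_⟩
  have hstep : ∀ i, x * g (f i * (g ^ i) z) = f (i + 1) * (g ^ (i + 1)) z := by
    intro i
    rw [map_mul, hf]
    simp only
    rw [Finset.prod_range_succ', map_prod, pow_zero, ← mul_assoc, pow_succ']
    simp only [pow_succ', AlgEquiv.mul_apply, AlgEquiv.one_apply]
    ring
  rw [map_sum, Finset.mul_sum, Finset.sum_congr rfl fun i _ => hstep i]
  have h1 := Finset.sum_range_succ (fun i => f i * (g ^ i) z) n
  rw [Finset.sum_range_succ'] at h1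
  have h2 : f n * (g ^ n) z = f 0 * (g ^ 0) z := by
    rw [← hg, pow_orderOf_eq_one, hg, pow_zero]
    simp only [hf, hx, Finset.range_zero, Finset.prod_empty]
  rw [h2] at h1
  exact add_right_cancel h1

end Hilbert90

/-! ### Units of totally real fields -/

section TotallyReal

open NumberField

lemma units_rank_of_isTotallyReal (E : Type*) [Field E] [NumberField E] [IsTotallyReal E] :
    Module.finrank ℤ (Additive (𝓞 E)ˣ) = Module.finrank ℚ E - 1 := by
  rw [Units.finrank_eq, Units.rank, IsTotallyReal.finrank,
    InfinitePlace.card_eq_nrRealPlaces_add_nrComplexPlaces, IsTotallyReal.nrComplexPlaces_eq_zero,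
    add_zero]

lemma eq_one_of_pow_eq_one_of_isTotallyReal {E : Type*} [Field E] [NumberField E]
    [IsTotallyReal E] {p : ℕ} (hp : Odd p) {x : E} (hx : x ^ p = 1) : x = 1 := by
  obtain ⟨w⟩ : Nonempty (InfinitePlace E) := inferInstance
  let φ : E →+* ℝ := InfinitePlace.embedding_of_isReal (IsTotallyReal.isReal w)
  apply φ.injective
  apply hp.strictMono_pow.injective
  change φ x ^ p = φ 1 ^ p
  rw [← map_pow, hx, map_one, one_pow]

end TotallyReal

/-! ### Ambiguous principal ideals of a cyclic extension -/

section Cyclic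

variable {K N : Type*} [Field K] [Field N] [Algebra K N]

/-- The homomorphism `x ↦ x / g x` on `Nˣ`. -/
def divConj (g : N ≃ₐ[K] N) : Nˣ →* Nˣ := MonoidHom.id Nˣ / Units.map ((g : N →+* N) : N →* N)

lemma divConj_apply (g : N ≃ₐ[K] N) (x : Nˣ) :
    divConj g x = x / Units.map ((g : N →+* N) : N →* N) x := rfl

/-- The action of `g` on the unit group. -/
def unitConj (g : N ≃ₐ[K] N) : (𝓞 N)ˣ →* (𝓞 N)ˣ :=
  Units.map (NumberField.RingOfIntegers.mapRingHom (g : N →+* N) : 𝓞 N →* 𝓞 N)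

lemma unitConj_iterate (g : N ≃ₐ[K] N) (i : ℕ) (u : (𝓞 N)ˣ) :
    (((unitConj g)^[i] u : (𝓞 N)ˣ) : N) = (g ^ i) (u : N) := by
  induction i with
  | zero => rfl
  | succ i ih =>
    rw [Function.iterate_succ_apply', pow_succ']
    exact congr_arg g ih

/-- The inclusion of the unit group in `Nˣ`. -/
def unitEmb (N : Type*) [Field N] [NumberField N] : (𝓞 N)ˣ →* Nˣ :=
  Units.map (algebraMap (𝓞 N) N : 𝓞 N →* N)

variable [NumberField N]

lemma unitEmb_injective : Function.Injective (unitEmb N) :=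
  Units.map_injective (FaithfulSMul.algebraMap_injective (𝓞 N) N)

lemma unitEmb_unitConj (g : N ≃ₐ[K] N) (u : (𝓞 N)ˣ) :
    unitEmb N (unitConj g u) = Units.map ((g : N →+* N) : N →* N) (unitEmb N u) := rfl

lemma prin_unitEmb (u : (𝓞 N)ˣ) : prin N (unitEmb N u) = 1 := prin_eq_one_iff.mpr ⟨u, rfl⟩

lemma ker_prin : (prin N).ker = (unitEmb N).range := by
  ext x
  exact prin_eq_one_iff

lemma divConj_mem_range_unitEmb_iff {g : N ≃ₐ[K] N} {x : Nˣ} :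
    divConj g x ∈ (unitEmb N).range ↔ prin N (Units.map ((g : N →+* N) : N →* N) x) = prin N x := by
  rw [← ker_prin, MonoidHom.mem_ker, divConj_apply, map_div, div_eq_one, eq_comm]

/-- The extension of units from `K` to `N`. -/
def unitExt (K N : Type*) [Field K] [NumberField K] [Field N] [NumberField N] [Algebra K N] :
    (𝓞 K)ˣ →* (𝓞 N)ˣ := Units.map (algebraMap (𝓞 K) (𝓞 N) : 𝓞 K →* 𝓞 N)

/-- The extension of nonzero elements from `K` to `N`. -/
def fieldExt (K N : Type*) [Field K] [Field N] [Algebra K N] :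
    Kˣ →* Nˣ := Units.map (algebraMap K N : K →* N)

variable [NumberField K]

lemma unitExt_injective : Function.Injective (unitExt K N) :=
  Units.map_injective (FaithfulSMul.algebraMap_injective (𝓞 K) (𝓞 N))

lemma map_prin_range_fieldExt : (fieldExt K N).range.map (prin N) = basePrincipalIdeals K N := by
  rw [basePrincipalIdeals, principalIdeals, MonoidHom.map_range, MonoidHom.map_range]
  congr 1
  ext1 x
  exact (extendIdeal_prin K x).symm

/-- Automorphisms over `K` fix the ambiguous principal ideals, because the group of fractional
ideals is torsion-free. -/
lemma prin_conj_eq_of_mem_ambiguousIdeals {n : ℕ} (hn : n ≠ 0) (s : N ≃ₐ[K] N) {x : Nˣ}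
    (hx : prin N x ∈ ambiguousIdeals K N n) :
    prin N (Units.map ((s : N →+* N) : N →* N) x) = prin N x := by
  obtain ⟨J, hJ⟩ := hx
  obtain ⟨h, h0, hh⟩ := exists_pow_mem_principal K
  obtain ⟨y, hy⟩ := hh J
  have h1 : prin N x ^ (n * h) = prin N (fieldExt K N y) := by
    have hJ' : extendIdeal K N J = prin N x ^ n := hJ
    rw [pow_mul, ← hJ', ← map_pow, ← hy, extendIdeal_prin]; rfl
  rw [← map_pow, ← div_eq_one, ← map_div] at h1
  obtain ⟨u, hu⟩ := prin_eq_one_iff.mp h1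
  have hxu : x ^ (n * h) = unitEmb N u * fieldExt K N y := by
    rw [eq_comm, ← eq_div_iff_mul_eq']; exact hu
  apply pow_left_injective (mul_ne_zero hn h0)
  simp only
  rw [← map_pow, ← map_pow, ← map_pow, hxu, map_mul, map_mul, map_mul, ← unitEmb_unitConj,
    prin_unitEmb, prin_unitEmb]
  congr 2
  exact Units.ext (s.commutes (y : K))

variable [IsGalois K N] {p : ℕ} {g : N ≃ₐ[K] N}

lemma orderOf_generator (hKN : Module.finrank K N = p) (hg : ∀ x, x ∈ Subgroup.zpowers g) :
    orderOf g = p := by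
  rw [← hKN, ← IsGalois.card_aut_eq_finrank, orderOf_eq_card_of_forall_mem_zpowers hg]

lemma algebraMap_norm_eq_prod (hKN : Module.finrank K N = p)
    (hg : ∀ x, x ∈ Subgroup.zpowers g) (x : N) :
    algebraMap K N (Algebra.norm K x) = ∏ i ∈ Finset.range p, (g ^ i) x := by
  classical
  rw [Algebra.norm_eq_prod_automorphisms]
  have ho := orderOf_generator hKN hg
  symm
  refine Finset.prod_bij (fun i _ => g ^ i) (fun _ _ => Finset.mem_univ _) ?_ ?_ (fun _ _ => rfl)
  · intro i hi j hj hij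
    rw [Finset.mem_range, ← ho] at hi hj
    exact pow_injOn_Iio_orderOf hi hj hij
  · intro s _
    obtain ⟨i, hi, rfl⟩ := (mem_zpowers_iff_mem_range_orderOf.mp (hg s) : _) |> Finset.mem_image.mp
    exact ⟨i, by rwa [ho] at hi, rfl⟩

lemma exists_algebraMap_eq_of_fixed (hg : ∀ x, x ∈ Subgroup.zpowers g) {x : N} (hx : g x = x) :
    ∃ y : K, algebraMap K N y = x := by
  rw [← Set.mem_range, IsGalois.mem_range_algebraMap_iff_fixed]
  intro s
  obtain ⟨k, rfl⟩ := hg s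
  have : g ∈ MulAction.stabilizer (N ≃ₐ[K] N) x := hx
  exact Subgroup.zpow_mem _ this k

lemma ker_divConj (hg : ∀ x, x ∈ Subgroup.zpowers g) : (divConj g).ker = (fieldExt K N).range := by
  ext x
  rw [MonoidHom.mem_ker, divConj_apply, div_eq_one]
  constructor
  · intro h
    obtain ⟨y, hy⟩ := exists_algebraMap_eq_of_fixed hg (congr_arg Units.val h).symm
    have hy0 : y ≠ 0 := by
      rintro rfl
      exact x.ne_zero (by rw [← hy, map_zero])
    exact ⟨Units.mk0 y hy0, Units.ext hy⟩
  · rintro ⟨y, rfl⟩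
    exact Units.ext (g.commutes (y : K)).symm

lemma ker_div_unitConj (hg : ∀ x, x ∈ Subgroup.zpowers g) :
    (MonoidHom.id _ / unitConj g).ker = (unitExt K N).range := by
  ext u
  rw [MonoidHom.mem_ker, MonoidHom.div_apply, div_eq_one]
  constructor
  · intro h
    have hfix : ∀ v : (𝓞 N)ˣ, v = unitConj g v → ∃ y : 𝓞 K, algebraMap (𝓞 K) (𝓞 N) y = v := by
      intro v hv
      have hv' : g (v : 𝓞 N) = ((v : 𝓞 N) : N) :=
        (congr_arg (fun w : (𝓞 N)ˣ => ((w : 𝓞 N) : N)) hv).symm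
      obtain ⟨y, hy⟩ := exists_algebraMap_eq_of_fixed hg hv'
      have hyi : IsIntegral ℤ y := by
        rw [← isIntegral_algebraMap_iff (algebraMap K N).injective, hy]
        exact NumberField.RingOfIntegers.isIntegral_coe _
      exact ⟨⟨y, hyi⟩, NumberField.RingOfIntegers.ext hy⟩
    obtain ⟨a, ha⟩ := hfix u h
    obtain ⟨b, hb⟩ := hfix u⁻¹ (by rw [map_inv]; exact congr_arg _ h)
    have hab : a * b = 1 := by
      apply FaithfulSMul.algebraMap_injective (𝓞 K) (𝓞 N)
      rw [map_mul, ha, hb, map_one, Units.mul_inv]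
    exact ⟨⟨a, b, hab, by rw [mul_comm, hab]⟩, Units.ext ha⟩
  · rintro ⟨y, rfl⟩
    refine Units.ext (NumberField.RingOfIntegers.ext ?_)
    exact (g.commutes ((y : 𝓞 K) : K)).symm

/-- The Herbrand quotient of the unit group of a cyclic extension of odd prime degree `p` of a real
quadratic field, the top field being totally real: `#H⁻¹ = p * #H⁰`. -/
lemma relIndex_units_eq [NumberField.IsTotallyReal N] (hp : p.Prime) (hp2 : p ≠ 2)
    (hKN : Module.finrank K N = p) (hK : Module.finrank ℚ K = 2)
    (hg : ∀ x, x ∈ Subgroup.zpowers g) :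
    (MonoidHom.id _ / unitConj g).range.relIndex (unitNorm K N).ker =
        p * (unitNorm K N).range.index ∧
      (unitNorm K N).range.index ∣ p := by
  have : Fact p.Prime := ⟨hp⟩
  have : NumberField.IsTotallyReal K := NumberField.IsTotallyReal.of_algebra K N
  have hN : Module.finrank ℚ N = 2 * p := by rw [← Module.finrank_mul_finrank ℚ K N, hK, hKN]
  have key := relIndex_ker_norm_eq p (G := (𝓞 N)ˣ)
    (fun u hu => by
      have : (u : N) ^ p = 1 := by
        have := congr_arg (fun w : (𝓞 N)ˣ => ((w : 𝓞 N) : N)) hu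
        simpa using this
      have := eq_one_of_pow_eq_one_of_isTotallyReal (hp.odd_of_ne_two hp2) this
      exact Units.ext (NumberField.RingOfIntegers.ext this))
    (unitConj g) (MonoidHom.id _ / unitConj g) ((unitExt K N).comp (unitNorm K N))
    (fun u => by
      refine Units.ext (NumberField.RingOfIntegers.ext ?_)
      refine (unitConj_iterate g p u).trans ?_
      rw [← orderOf_generator hKN hg, pow_orderOf_eq_one]; rfl)
    (fun u => rfl)
    (fun u => by
      refine Units.ext (NumberField.RingOfIntegers.ext ?_)
      rw [Units.coe_prod]
      refine (algebraMap_norm_eq_prod hKN hg (u : N)).trans (.trans ?_ (map_prod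
        (algebraMap (𝓞 N) N) _ _).symm)
      exact Finset.prod_congr rfl fun i _ => (unitConj_iterate g i u).symm)
    (by rw [units_rank_of_isTotallyReal, hN])
    (by
      rw [ker_div_unitConj hg]
      have e : (𝓞 K)ˣ ≃* (unitExt K N).range := MonoidHom.ofInjective unitExt_injective
      rw [← (AddEquiv.toIntLinearEquiv (MulEquiv.toAdditive e)).finrank_eq,
        units_rank_of_isTotallyReal, hK])
  have h1 : ((unitExt K N).comp (unitNorm K N)).ker = (unitNorm K N).ker := by
    ext u
    simp only [MonoidHom.mem_ker, MonoidHom.comp_apply]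
    exact ⟨fun h => unitExt_injective (h.trans (map_one _).symm), fun h => by rw [h, map_one]⟩
  have h2 : ((unitExt K N).comp (unitNorm K N)).range.relIndex (MonoidHom.id _ / unitConj g).ker =
      (unitNorm K N).range.index := by
    rw [ker_div_unitConj hg, ← MonoidHom.map_range, MonoidHom.range_eq_map (unitExt K N),
      Subgroup.relIndex_map_map_of_injective _ _ unitExt_injective, Subgroup.relIndex_top_right]
  rwa [h1, h2] at key

/-- The `p`-th power of an invariant principal ideal is generated by the norm of a generator. -/
lemma prin_pow_eq_extendIdeal_norm (hKN : Module.finrank K N = p)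
    (hg : ∀ x, x ∈ Subgroup.zpowers g) {x : Nˣ}
    (hx : prin N (Units.map ((g : N →+* N) : N →* N) x) = prin N x) :
    prin N x ^ p = extendIdeal K N (prin K (Units.map (Algebra.norm K : N →* K) x)) := by
  have hi : ∀ i : ℕ, prin N (Units.map (((g ^ i : N ≃ₐ[K] N) : N →+* N) : N →* N) x) =
      prin N x := by
    have hpr : ∀ z : Nˣ, prin N z = prin N x →
        prin N (Units.map ((g : N →+* N) : N →* N) z) = prin N x := by
      intro z hz
      rw [← div_eq_one, ← map_div] at hz
      obtain ⟨u, hu⟩ := prin_eq_one_iff.mp hz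
      have : z = unitEmb N u * x := by rw [eq_comm, ← eq_div_iff_mul_eq']; exact hu
      rw [this, map_mul, map_mul, ← unitEmb_unitConj, prin_unitEmb, one_mul, hx]
    intro i
    induction i with
    | zero => rfl
    | succ i ih =>
      refine Eq.trans ?_ (hpr _ ih)
      rw [pow_succ']
      rfl
  have h2 : fieldExt K N (Units.map (Algebra.norm K : N →* K) x) =
      ∏ i ∈ Finset.range p, Units.map (((g ^ i : N ≃ₐ[K] N) : N →+* N) : N →* N) x := by
    refine Units.ext ?_
    rw [Units.coe_prod]
    exact algebraMap_norm_eq_prod hKN hg (x : N)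
  rw [extendIdeal_prin]
  change _ = prin N (fieldExt K N _)
  rw [h2, map_prod, Finset.prod_congr rfl fun i _ => hi i, Finset.prod_const, Finset.card_range]

lemma map_prin_comap_divConj (hp : p.Prime) (hKN : Module.finrank K N = p)
    (hg : ∀ x, x ∈ Subgroup.zpowers g) :
    ((unitEmb N).range.comap (divConj g)).map (prin N) = ambiguousPrincipalIdeals K N p := by
  ext I
  constructor
  · rintro ⟨x, hx, rfl⟩
    refine ⟨⟨_, (prin_pow_eq_extendIdeal_norm hKN hg ?_).symm⟩, x, rfl⟩
    exact divConj_mem_range_unitEmb_iff.mp hx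
  · rintro ⟨hI, x, rfl⟩
    exact ⟨x, divConj_mem_range_unitEmb_iff.mpr
      (prin_conj_eq_of_mem_ambiguousIdeals hp.ne_zero g hI), rfl⟩

/-- Hilbert's Theorem 90: the elements `x / g x` which are units are the units of norm `1`. -/
lemma map_divConj_comap (hp : p.Prime) (hKN : Module.finrank K N = p)
    (hg : ∀ x, x ∈ Subgroup.zpowers g) :
    ((unitEmb N).range.comap (divConj g)).map (divConj g) =
      (unitNorm K N).ker.map (unitEmb N) := by
  ext z
  constructor
  · rintro ⟨x, ⟨u, hu⟩, rfl⟩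
    refine ⟨u, Units.ext (NumberField.RingOfIntegers.ext ?_), hu⟩
    change Algebra.norm K (u : N) = 1
    have h1 : (u : N) * g x = x := by
      have := eq_div_iff_mul_eq'.mp (hu.trans (divConj_apply g x))
      exact congr_arg Units.val this
    have h2 := congr_arg (Algebra.norm K) h1
    rw [map_mul, Algebra.norm_eq_of_algEquiv g] at h2
    exact (mul_eq_right₀ (Algebra.norm_ne_zero_iff.mpr x.ne_zero)).mp h2
  · rintro ⟨u, hu, rfl⟩
    have ho := orderOf_generator hKN hg
    have h1 : ∏ i ∈ Finset.range p, (g ^ i) (u : N) = 1 := by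
      have h3 : Algebra.norm K (u : N) = 1 :=
        congr_arg (fun w : (𝓞 K)ˣ => ((w : 𝓞 K) : K)) hu
      rw [← algebraMap_norm_eq_prod hKN hg, h3, map_one]
    obtain ⟨y, hy0, hy⟩ := exists_mul_conj_eq_of_prod_eq_one g ho hp.ne_zero _ h1
    have h4 : divConj g (Units.mk0 y hy0) = unitEmb N u := by
      rw [divConj_apply, div_eq_iff_eq_mul]
      exact Units.ext hy.symm
    exact ⟨Units.mk0 y hy0, ⟨u, h4.symm⟩, h4⟩

/-- The primitive ambiguous principal ideals of `N/K` form the group `H¹(⟨g⟩, U_N)`, whose order is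
given by the Herbrand quotient. -/
theorem relIndex_ambiguousPrincipalIdeals [NumberField.IsTotallyReal N] (hp : p.Prime)
    (hp2 : p ≠ 2) (hKN : Module.finrank K N = p) (hK : Module.finrank ℚ K = 2)
    (hg : ∀ x, x ∈ Subgroup.zpowers g) :
    (basePrincipalIdeals K N).relIndex (ambiguousPrincipalIdeals K N p) =
      p * (unitNorm K N).range.index := by
  set W := (unitEmb N).range.comap (divConj g)
  have hYW : (divConj g).ker ≤ W := MonoidHom.ker_le_comap _ _
  have hUW : (unitEmb N).range ≤ W := by
    rintro _ ⟨u, rfl⟩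
    exact ⟨u / unitConj g u, map_div _ _ _⟩
  have h1 : ((unitEmb N).range.map (divConj g)).relIndex (W.map (divConj g)) =
      (MonoidHom.id _ / unitConj g).range.relIndex (unitNorm K N).ker := by
    rw [map_divConj_comap hp hKN hg, ← Subgroup.relIndex_map_map_of_injective _ _ unitEmb_injective,
      MonoidHom.map_range, MonoidHom.map_range]
    congr 2
  rw [← (relIndex_units_eq hp hp2 hKN hK hg).1, ← h1, Subgroup.relIndex_map_map,
    ← map_prin_comap_divConj hp hKN hg, ← map_prin_range_fieldExt, Subgroup.relIndex_map_map,
    ker_prin, ← ker_divConj hg, sup_of_le_left hYW, sup_of_le_left hUW, sup_comm]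

end Cyclic

/-! ### Elementary abelian groups and indices -/

section FpDim

lemma HasFpDim.card_eq {p : ℕ} [Fact p.Prime] {G : Type*} [CommGroup G] {d : ℕ}
    (h : HasFpDim p G d) : Nat.card G = p ^ d := by
  obtain ⟨e⟩ := h
  rw [Nat.card_congr (Additive.ofMul.trans e.toEquiv), Nat.card_fun, Nat.card_zmod, Nat.card_fin]

/-- Here `Nat.card G ≠ 0` expresses that `G` is finite. -/
lemma exists_hasFpDim {p : ℕ} [hp : Fact p.Prime] {G : Type*} [CommGroup G]
    (hG : Nat.card G ≠ 0) (h : ∀ g : G, g ^ p = 1) : ∃ d, HasFpDim p G d := by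
  have : Finite G := Nat.finite_of_card_ne_zero hG
  let : Module (ZMod p) (Additive G) := AddCommGroup.zmodModule (n := p) fun g => h g.toMul
  exact ⟨_, ⟨(Module.finBasis (ZMod p) (Additive G)).equivFun.toAddEquiv⟩⟩

end FpDim

section Groups

lemma card_map_eq_relIndex {G H : Type*} [Group G] [Group H] (f : G →* H)
    (S : Subgroup G) : Nat.card (S.map f) = f.ker.relIndex S := by
  rw [← Subgroup.relIndex_bot_left, ← Subgroup.relIndex_comap]; rfl

lemma mem_of_sq_mem_of_pow_mem {G : Type*} [CommGroup G] {S : Subgroup G} {x : G} {n : ℕ}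
    (hn : Odd n) (h2 : x ^ 2 ∈ S) (hx : x ^ n ∈ S) : x ∈ S := by
  obtain ⟨k, rfl⟩ := hn
  -- `x = x ^ (2 * k + 1) / (x ^ 2) ^ k`
  rw [pow_succ, pow_mul] at hx
  exact (Subgroup.mul_mem_cancel_left S (S.pow_mem h2 k)).mp hx

end Groups

/-! ### The capitulation kernel -/

section Capitulation

variable {K N : Type*} [Field K] [NumberField K] [Field N] [NumberField N] [Algebra K N]

lemma classGroup_mk_eq_one_iff {I : FracIdeals K} :
    ClassGroup.mk K I = 1 ↔ I ∈ principalIdeals K := by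
  rw [ClassGroup.mk_eq_one_iff, FractionalIdeal.isPrincipal_iff]
  constructor
  · rintro ⟨x, hx⟩
    exact mem_principal_ideals_iff.mpr ⟨x, hx.symm⟩
  · rintro ⟨x, rfl⟩
    exact ⟨x, coe_toPrincipalIdeal x⟩

lemma classGroup_mk_surjective : Function.Surjective (ClassGroup.mk K : FracIdeals K →* _) := by
  intro c
  obtain ⟨J, rfl⟩ := ClassGroup.mk0_surjective c
  exact ⟨FractionalIdeal.mk0 K J, ClassGroup.mk_mk0 K J⟩

/-- `transfer` is defined through the fraction field of the ring of integers; this is its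
description by fractional ideals of `K` and `N`. -/
lemma transfer_mk (I : FracIdeals K) :
    transfer K N (ClassGroup.mk K I) = ClassGroup.mk N (extendIdeal K N I) := by
  obtain ⟨J, hJ⟩ := ClassGroup.mk0_surjective (ClassGroup.mk K I)
  have h1 : ClassGroup.mk K (I / FractionalIdeal.mk0 K J) = 1 := by
    rw [map_div, ClassGroup.mk_mk0, hJ, div_self']
  obtain ⟨x, hx⟩ := classGroup_mk_eq_one_iff.mp h1
  have h2 : ClassGroup.mk N (extendIdeal K N I) =
      ClassGroup.mk N (extendIdeal K N (FractionalIdeal.mk0 K J)) := by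
    rw [← div_eq_one, ← map_div, ← map_div, ← hx, extendIdeal_prin, classGroup_mk_eq_one_iff]
    exact ⟨_, rfl⟩
  rw [h2, ← hJ, transfer, ClassGroup.extendedHom_mk0, ← ClassGroup.mk_mk0 N]
  congr 1
  refine Units.ext ?_
  exact (FractionalIdeal.extendedHom_coeIdeal_eq_map N (𝓞 N) (J : Ideal (𝓞 K))).symm

lemma ker_transfer :
    (transfer K N).ker =
      ((principalIdeals N).comap (extendIdeal K N)).map (ClassGroup.mk K) := by
  ext c
  obtain ⟨I, rfl⟩ := classGroup_mk_surjective c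
  rw [MonoidHom.mem_ker, transfer_mk, classGroup_mk_eq_one_iff]
  constructor
  · intro h
    exact ⟨I, h, rfl⟩
  · rintro ⟨J, hJ, hIJ⟩
    have h1 : I / J ∈ principalIdeals K := by
      rw [← classGroup_mk_eq_one_iff, map_div, hIJ, div_self']
    obtain ⟨x, hx⟩ := h1
    have h2 : I = prin K x * J := by rw [hx, div_mul_cancel]
    rw [h2, map_mul, extendIdeal_prin]
    exact mul_mem ⟨_, rfl⟩ hJ

lemma card_ker_transfer (p : ℕ) :
    Nat.card (transfer K N).ker =
      (basePrincipalIdeals K N).relIndex (ambiguousPrincipalIdeals K N p ⊓ baseIdeals K N) := by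
  have hker : (ClassGroup.mk K : FracIdeals K →* ClassGroup (𝓞 K)).ker = principalIdeals K := by
    ext I; exact classGroup_mk_eq_one_iff
  rw [ker_transfer, card_map_eq_relIndex, hker,
    ← Subgroup.relIndex_map_map_of_injective _ _ (extendIdeal_injective (E := N) K),
    Subgroup.map_comap_eq]
  congr 1
  ext I
  constructor
  · rintro ⟨h1, h2⟩
    exact ⟨⟨baseIdeals_le_ambiguousIdeals K p h1, h2⟩, h1⟩
  · rintro ⟨⟨_, h2⟩, h1⟩
    exact ⟨h1, h2⟩

/-- If `I` becomes principal in `N`, generated by `x`, then `I ^ p` is generated by the norm of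
`x`. -/
lemma pow_eq_one_of_mem_ker_transfer [IsGalois K N] {p : ℕ} (hp : p.Prime)
    (hKN : Module.finrank K N = p) {g : N ≃ₐ[K] N} (hg : ∀ x, x ∈ Subgroup.zpowers g)
    (c : (transfer K N).ker) : c ^ p = 1 := by
  obtain ⟨c, hc⟩ := c
  rw [Subtype.ext_iff, Subgroup.coe_pow, Subgroup.coe_one]
  simp only
  rw [ker_transfer] at hc
  obtain ⟨I, ⟨x, hx⟩, rfl⟩ := hc
  have hx' : prin N x = extendIdeal K N I := hx
  have h1 := prin_pow_eq_extendIdeal_norm hKN hg (x := x)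
    (prin_conj_eq_of_mem_ambiguousIdeals hp.ne_zero g
      (baseIdeals_le_ambiguousIdeals K p ⟨I, hx'.symm⟩))
  rw [hx', ← map_pow] at h1
  rw [← map_pow, extendIdeal_injective K h1, classGroup_mk_eq_one_iff]
  exact ⟨_, rfl⟩

end Capitulation

/-! ### Absolute and relative principal factors -/

section Square

variable {K L N : Type*} [Field K] [NumberField K] [Field L] [NumberField L] [Field N]
  [NumberField N] [Algebra K N] [Algebra L N] {p : ℕ}

lemma extendIdeal_extendIdeal_rat (I : FracIdeals ℚ) :
    extendIdeal L N (extendIdeal ℚ L I) = extendIdeal K N (extendIdeal ℚ K I) := by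
  have : (extendIdeal L N).comp (extendIdeal ℚ L) = (extendIdeal K N).comp (extendIdeal ℚ K) := by
    refine fracIdeals_hom_ext fun x => ?_
    simp only [MonoidHom.comp_apply, extendIdeal_prin]
    congr 1
    ext
    simp
  exact DFunLike.congr_fun this I

/-- Base change for the relative norm of ideals. It suffices to know it for elements, because
homomorphisms on fractional ideals are determined by principal ideals. -/
lemma idealNorm_extendIdeal_eq
    (hnorm : ∀ x : K, Algebra.norm L (algebraMap K N x) = algebraMap ℚ L (Algebra.norm ℚ x))
    (I : FracIdeals K) :
    idealNorm L N (extendIdeal K N I) = extendIdeal ℚ L (idealNorm ℚ K I) := by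
  have : (idealNorm L N).comp (extendIdeal K N) = (extendIdeal ℚ L).comp (idealNorm ℚ K) := by
    refine fracIdeals_hom_ext fun x => ?_
    simp only [MonoidHom.comp_apply, extendIdeal_prin, idealNorm_prin]
    congr 1
    ext
    exact hnorm x
  exact DFunLike.congr_fun this I

lemma baseIdeals_le_comap_idealNorm
    (hnorm : ∀ x : K, Algebra.norm L (algebraMap K N x) = algebraMap ℚ L (Algebra.norm ℚ x)) :
    baseIdeals K N ≤ (baseIdeals ℚ L).comap (idealNorm L N) := by
  rintro _ ⟨I, rfl⟩
  exact ⟨_, (idealNorm_extendIdeal_eq hnorm I).symm⟩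

lemma idealNorm_pow_mem
    (hnorm : ∀ x : K, Algebra.norm L (algebraMap K N x) = algebraMap ℚ L (Algebra.norm ℚ x))
    {I : FracIdeals N} (hI : I ∈ ambiguousIdeals K N p) :
    idealNorm L N I ^ p ∈ baseIdeals ℚ L := by
  rw [← map_pow]
  exact baseIdeals_le_comap_idealNorm hnorm hI

lemma sup_le_ambiguousIdeals :
    ambiguousPrincipalIdeals K N p ⊔ baseIdeals K N ≤ ambiguousIdeals K N p :=
  sup_le inf_le_left (baseIdeals_le_ambiguousIdeals K p)

/-- Modulo ideals of `ℚ`, the norm maps the ambiguous principal ideals of `N/K` onto those of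
`L/ℚ`: on the latter, extension followed by norm is squaring, which is invertible on a group of odd
exponent `p`. -/
lemma map_idealNorm_sup_eq (hp : Odd p) (hLN : Module.finrank L N = 2)
    (hnorm : ∀ x : K, Algebra.norm L (algebraMap K N x) = algebraMap ℚ L (Algebra.norm ℚ x)) :
    (ambiguousPrincipalIdeals K N p ⊔ baseIdeals K N).map (idealNorm L N) ⊔ baseIdeals ℚ L =
      ambiguousPrincipalIdeals ℚ L p := by
  have hbase : baseIdeals ℚ L ≤ ambiguousPrincipalIdeals ℚ L p := by
    rw [← basePrincipalIdeals_rat]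
    exact basePrincipalIdeals_le_ambiguousPrincipalIdeals ℚ p
  apply le_antisymm
  · refine sup_le ?_ hbase
    rw [Subgroup.map_le_iff_le_comap]
    refine sup_le ?_ ((baseIdeals_le_comap_idealNorm hnorm).trans (Subgroup.comap_mono hbase))
    rintro _ ⟨hI, x, rfl⟩
    exact ⟨idealNorm_pow_mem hnorm hI, ⟨_, (idealNorm_prin L x).symm⟩⟩
  · rintro I ⟨⟨J, hJ⟩, x, rfl⟩
    refine mem_of_sq_mem_of_pow_mem hp (Subgroup.mem_sup_left ?_) (Subgroup.mem_sup_right ⟨J, hJ⟩)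
    rw [← hLN, ← idealNorm_extendIdeal]
    refine Subgroup.mem_map_of_mem _ (Subgroup.mem_sup_left ⟨⟨extendIdeal ℚ K J, ?_⟩, ?_⟩)
    · rw [← extendIdeal_extendIdeal_rat (L := L), hJ]
      exact map_pow _ _ _
    · exact ⟨_, (extendIdeal_prin L x).symm⟩

lemma card_principalFactors_rat (hp : Odd p) (hLN : Module.finrank L N = 2)
    (hnorm : ∀ x : K, Algebra.norm L (algebraMap K N x) = algebraMap ℚ L (Algebra.norm ℚ x)) :
    Nat.card (PrincipalFactors ℚ L p) =
      ((baseIdeals ℚ L).comap (idealNorm L N)).relIndex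
        (ambiguousPrincipalIdeals K N p ⊔ baseIdeals K N) := by
  change (basePrincipalIdeals ℚ L).relIndex (ambiguousPrincipalIdeals ℚ L p) = _
  rw [basePrincipalIdeals_rat, ← map_idealNorm_sup_eq hp hLN hnorm, Subgroup.relIndex_sup_right,
    Subgroup.relIndex_comap]

/-- Both groups intersected in `relativePrincipalFactors` contain `𝓘_K`, so the intersection can be
taken before passing to the quotient. -/
lemma relativePrincipalFactors_eq_map
    (hnorm : ∀ x : K, Algebra.norm L (algebraMap K N x) = algebraMap ℚ L (Algebra.norm ℚ x)) :
    relativePrincipalFactors K L N p =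
      ((ambiguousPrincipalIdeals K N p ⊔ baseIdeals K N) ⊓
        (baseIdeals ℚ L).comap (idealNorm L N)).map (QuotientGroup.mk' (baseIdeals K N)) := by
  apply le_antisymm
  · rintro _ ⟨⟨I, ⟨_, hI⟩, rfl⟩, J, hJ, hIJ⟩
    refine ⟨J, ⟨hJ, ?_⟩, hIJ⟩
    obtain ⟨z, hz, rfl⟩ := (QuotientGroup.mk'_eq_mk' _).mp hIJ.symm
    exact (Subgroup.mul_mem_cancel_left _ hI).mp
      (mul_mem hI (mul_mem hI (baseIdeals_le_comap_idealNorm hnorm hz)))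
  · rintro _ ⟨I, ⟨h1, h2⟩, rfl⟩
    exact ⟨⟨I, ⟨sup_le_ambiguousIdeals h1, h2⟩, rfl⟩, ⟨I, h1, rfl⟩⟩

/-- The decomposition of the ambiguous principal ideals of `N/K` into absolute principal factors,
relative principal factors and capitulation kernel. -/
lemma card_mul_card_mul_card (hp : Odd p) (hLN : Module.finrank L N = 2)
    (hnorm : ∀ x : K, Algebra.norm L (algebraMap K N x) = algebraMap ℚ L (Algebra.norm ℚ x)) :
    Nat.card (PrincipalFactors ℚ L p) * Nat.card (relativePrincipalFactors K L N p) *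
      Nat.card (transfer K N).ker =
      (basePrincipalIdeals K N).relIndex (ambiguousPrincipalIdeals K N p) := by
  rw [card_principalFactors_rat hp hLN hnorm, relativePrincipalFactors_eq_map hnorm,
    card_map_eq_relIndex, QuotientGroup.ker_mk', card_ker_transfer p]
  set V := ambiguousPrincipalIdeals K N p ⊔ baseIdeals K N with hV
  set R := (baseIdeals ℚ L).comap (idealNorm L N) with hR
  have h1 := Subgroup.relIndex_mul_relIndex (baseIdeals K N) (V ⊓ R) V
    (le_inf le_sup_right (baseIdeals_le_comap_idealNorm hnorm)) inf_le_left
  rw [Subgroup.inf_relIndex_left] at h1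
  have h2 := Subgroup.relIndex_mul_relIndex (basePrincipalIdeals K N)
    (ambiguousPrincipalIdeals K N p ⊓ baseIdeals K N) (ambiguousPrincipalIdeals K N p)
    (le_inf (basePrincipalIdeals_le_ambiguousPrincipalIdeals K p)
      (basePrincipalIdeals_le_baseIdeals K)) inf_le_left
  rw [Subgroup.inf_relIndex_left, ← Subgroup.relIndex_sup_right (ambiguousPrincipalIdeals K N p),
    ← hV, ← h1] at h2
  rw [← h2]
  ring

lemma principalFactors_rat_pow_eq_one (a : PrincipalFactors ℚ L p) : a ^ p = 1 := by
  obtain ⟨I, rfl⟩ := QuotientGroup.mk_surjective a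
  rw [← QuotientGroup.mk_pow, QuotientGroup.eq_one_iff, Subgroup.mem_subgroupOf,
    basePrincipalIdeals_rat]
  exact I.2.1

lemma relativePrincipalFactors_pow_eq_one (a : relativePrincipalFactors K L N p) : a ^ p = 1 := by
  obtain ⟨_, ⟨_, ⟨I, hI, rfl⟩⟩⟩ := a
  rw [Subtype.ext_iff, Subgroup.coe_pow, Subgroup.coe_one]
  simp only
  rw [← map_pow, QuotientGroup.mk'_apply, QuotientGroup.eq_one_iff]
  exact sup_le_ambiguousIdeals hI

/-- Existence of the invariants, and the relation between them. -/
theorem exists_hasInvariants [IsGalois K N] [NumberField.IsTotallyReal N] (hp : p.Prime)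
    (hp2 : p ≠ 2) (hKN : Module.finrank K N = p) (hK : Module.finrank ℚ K = 2)
    {g : N ≃ₐ[K] N} (hg : ∀ x, x ∈ Subgroup.zpowers g) (hLN : Module.finrank L N = 2)
    (hnorm : ∀ x : K, Algebra.norm L (algebraMap K N x) = algebraMap ℚ L (Algebra.norm ℚ x)) :
    ∃ U A R C : ℕ, HasInvariants p K L N U A R C ∧ U ≤ 1 ∧ U + 1 = A + R + C := by
  have : Fact p.Prime := ⟨hp⟩
  obtain ⟨U, hU, hUi⟩ := (Nat.dvd_prime_pow hp).mp
    ((pow_one p).symm ▸ (relIndex_units_eq hp hp2 hKN hK hg).2)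
  have hcard := card_mul_card_mul_card (hp.odd_of_ne_two hp2) hLN hnorm
  rw [relIndex_ambiguousPrincipalIdeals hp hp2 hKN hK hg, hUi] at hcard
  have hne : p * p ^ U ≠ 0 := mul_ne_zero hp.ne_zero (pow_ne_zero _ hp.ne_zero)
  have hne1 := hcard ▸ hne
  obtain ⟨A, hA⟩ := exists_hasFpDim (p := p) (left_ne_zero_of_mul (left_ne_zero_of_mul hne1))
    principalFactors_rat_pow_eq_one
  obtain ⟨R, hR⟩ := exists_hasFpDim (p := p) (right_ne_zero_of_mul (left_ne_zero_of_mul hne1))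
    relativePrincipalFactors_pow_eq_one
  obtain ⟨C, hC⟩ := exists_hasFpDim (p := p) (right_ne_zero_of_mul hne1)
    (pow_eq_one_of_mem_ker_transfer hp hKN hg)
  refine ⟨U, A, R, C, ⟨hUi, hA, hR, hC⟩, hU, ?_⟩
  rw [hA.card_eq, hR.card_eq, hC.card_eq, ← pow_add, ← pow_add, ← pow_succ'] at hcard
  exact (Nat.pow_right_injective hp.two_le hcard).symm

lemma HasInvariants.unique (hp : p.Prime) {U A R C U' A' R' C' : ℕ}
    (h : HasInvariants p K L N U A R C) (h' : HasInvariants p K L N U' A' R' C') :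
    U = U' ∧ A = A' ∧ R = R' ∧ C = C' := by
  have : Fact p.Prime := ⟨hp⟩
  have hinj := Nat.pow_right_injective hp.two_le
  exact ⟨hinj (h.unit_index.symm.trans h'.unit_index),
    hinj (h.absolute.card_eq.symm.trans h'.absolute.card_eq),
    hinj (h.relative.card_eq.symm.trans h'.relative.card_eq),
    hinj (h.capitulation.card_eq.symm.trans h'.capitulation.card_eq)⟩

/-- Membership in the relative principal factors, in terms of the involution `t` of `N/L`. -/
lemma idealNorm_mem_baseIdeals_iff (hp : Odd p) (hLN : Module.finrank L N = 2)
    (hnorm : ∀ x : K, Algebra.norm L (algebraMap K N x) = algebraMap ℚ L (Algebra.norm ℚ x))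
    {t : N ≃ₐ[ℚ] N} (ht : ∀ x : N, algebraMap L N (Algebra.norm L x) = x * t x) {x : Nˣ}
    (hx : prin N x ∈ ambiguousIdeals K N p) :
    idealNorm L N (prin N x) ∈ baseIdeals ℚ L ↔
      prin N (x * Units.map ((t : N →+* N) : N →* N) x) ∈ baseIdeals K N := by
  have hext : extendIdeal L N (idealNorm L N (prin N x)) =
      prin N (x * Units.map ((t : N →+* N) : N →* N) x) := by
    rw [idealNorm_prin, extendIdeal_prin]
    congr 1
    exact Units.ext (ht x)
  rw [← hext]
  constructor
  · rintro ⟨I, hI⟩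
    rw [← hI, extendIdeal_extendIdeal_rat (K := K)]
    exact ⟨_, rfl⟩
  · rintro ⟨I, hI⟩
    refine mem_of_sq_mem_of_pow_mem hp ?_ (idealNorm_pow_mem hnorm hx)
    rw [← hLN, ← idealNorm_extendIdeal, ← hI]
    exact baseIdeals_le_comap_idealNorm hnorm ⟨I, rfl⟩

/-- The relative principal factors do not depend on the choice of `L`: two involutions of `N` which
differ by an automorphism over `K` act in the same way on ambiguous ideals. -/
lemma relativePrincipalFactors_le {L' : Type*} [Field L'] [NumberField L'] [Algebra L' N]
    (hp : Odd p) (hLN : Module.finrank L N = 2) (hLN' : Module.finrank L' N = 2)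
    (hnorm : ∀ x : K, Algebra.norm L (algebraMap K N x) = algebraMap ℚ L (Algebra.norm ℚ x))
    (hnorm' : ∀ x : K, Algebra.norm L' (algebraMap K N x) = algebraMap ℚ L' (Algebra.norm ℚ x))
    {t t' : N ≃ₐ[ℚ] N} (ht : ∀ x : N, algebraMap L N (Algebra.norm L x) = x * t x)
    (ht' : ∀ x : N, algebraMap L' N (Algebra.norm L' x) = x * t' x) (s : N ≃ₐ[K] N)
    (hs : ∀ x, t' x = t (s x)) :
    relativePrincipalFactors K L N p ≤ relativePrincipalFactors K L' N p := by
  rw [relativePrincipalFactors_eq_map hnorm, relativePrincipalFactors_eq_map hnorm']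
  refine Subgroup.map_mono fun I hI => ⟨hI.1, ?_⟩
  obtain ⟨h1, h2⟩ := hI
  obtain ⟨_, ⟨hx, x, rfl⟩, J, hJ, rfl⟩ := Subgroup.mem_sup.mp h1
  have hx' : prin N x ∈ ambiguousIdeals K N p := hx
  refine mul_mem ?_ (baseIdeals_le_comap_idealNorm hnorm' hJ)
  have h3 := (Subgroup.mul_mem_cancel_right _ (baseIdeals_le_comap_idealNorm hnorm hJ)).mp h2
  refine (idealNorm_mem_baseIdeals_iff hp hLN' hnorm' ht' hx').mpr ?_
  have h4 := (idealNorm_mem_baseIdeals_iff hp hLN hnorm ht hx').mp h3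
  rw [map_mul] at h4 ⊢
  convert h4 using 2
  have h5 := prin_conj_eq_of_mem_ambiguousIdeals hp.pos.ne' s hx'
  rw [← div_eq_one, ← map_div] at h5
  obtain ⟨u, hu⟩ := prin_eq_one_iff.mp h5
  have h6 : Units.map ((s : N →+* N) : N →* N) x = unitEmb N u * x := by
    rw [eq_comm, ← eq_div_iff_mul_eq']; exact hu
  have h7 : Units.map ((t' : N →+* N) : N →* N) x =
      Units.map ((t : N →+* N) : N →* N) (Units.map ((s : N →+* N) : N →* N) x) :=
    Units.ext (hs x)
  rw [h7, h6, map_mul, map_mul, ← unitEmb_unitConj, prin_unitEmb, one_mul]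

end Square

/-! ### Subfields of a Galois field of degree `2 * p` -/

section GaloisGroup

lemma le_of_card_odd_of_index_two {G : Type*} [Group G] {H H' : Subgroup G} (hH : H.index = 2)
    (hH' : Odd (Nat.card H')) : H' ≤ H := by
  intro x hx
  obtain ⟨k, hk⟩ := hH'
  have h1 : x ^ (2 * k + 1) = 1 := by
    rw [← hk]
    exact congr_arg Subtype.val (pow_card_eq_one' (x := (⟨x, hx⟩ : H')))
  -- every element of odd order is a square, and squares lie in a subgroup of index two
  have h2 : x = (x⁻¹) ^ (2 * k) := by
    rw [pow_succ] at h1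
    rw [inv_pow]
    exact eq_inv_of_mul_eq_one_right h1
  rw [h2, pow_mul]
  exact pow_mem (Subgroup.sq_mem_of_index_two hH _) _

open IntermediateField

variable {N : Type*} [Field N] [NumberField N] {p : ℕ}

/-- The norms of `N/L` and `K/ℚ` are compatible, because `K` and `L` are linearly disjoint. -/
lemma norm_algebraMap_eq (hp : Odd p) (hN : Module.finrank ℚ N = 2 * p)
    {K L : IntermediateField ℚ N} (hK : Module.finrank ℚ K = 2) (hL : Module.finrank ℚ L = p)
    (x : K) : Algebra.norm L (algebraMap K N x) = algebraMap ℚ L (Algebra.norm ℚ x) := by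
  have hd : L.LinearDisjoint K := by
    apply LinearDisjoint.of_finrank_coprime
    rw [hK, hL]
    exact hp.coprime_two_right
  refine hd.norm_algebraMap ?_ x
  apply IntermediateField.eq_of_le_of_finrank_eq le_top
  rw [hd.finrank_sup, hK, hL, finrank_top', hN, mul_comm]

lemma finrank_top_eq {K : IntermediateField ℚ N} {q r : ℕ} (hN : Module.finrank ℚ N = q * r)
    (hq : q ≠ 0) (hK : Module.finrank ℚ K = q) : Module.finrank K N = r := by
  have h1 := Module.finrank_mul_finrank ℚ K N
  rw [hK, hN] at h1
  exact Nat.eq_of_mul_eq_mul_left (Nat.pos_of_ne_zero hq) h1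

variable [IsGalois ℚ N]

lemma exists_intermediateField_finrank_eq {q r : ℕ} (hq : q.Prime)
    (hN : Module.finrank ℚ N = q * r) :
    ∃ K : IntermediateField ℚ N, Module.finrank ℚ K = r := by
  have : Fact q.Prime := ⟨hq⟩
  obtain ⟨s, hs⟩ := exists_prime_orderOf_dvd_card' (G := N ≃ₐ[ℚ] N) q
    (by rw [IsGalois.card_aut_eq_finrank, hN]; exact dvd_mul_right _ _)
  refine ⟨fixedField (Subgroup.zpowers s), ?_⟩
  have h1 := Module.finrank_mul_finrank ℚ (fixedField (Subgroup.zpowers s)) N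
  rw [finrank_fixedField_eq_card, Nat.card_zpowers, hs, hN, mul_comm] at h1
  exact Nat.eq_of_mul_eq_mul_left hq.pos h1

lemma index_fixingSubgroup (K : IntermediateField ℚ N) :
    K.fixingSubgroup.index = Module.finrank ℚ K := by
  have h1 := K.fixingSubgroup.card_mul_index
  rw [IsGalois.card_fixingSubgroup_eq_finrank, IsGalois.card_aut_eq_finrank,
    ← Module.finrank_mul_finrank ℚ K N, mul_comm] at h1
  exact Nat.eq_of_mul_eq_mul_right Module.finrank_pos h1

/-- A Galois field of degree `2 * p` has only one quadratic subfield. -/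
lemma quadratic_subfield_unique (hp : Odd p) (hN : Module.finrank ℚ N = 2 * p)
    {K K' : IntermediateField ℚ N} (hK : Module.finrank ℚ K = 2)
    (hK' : Module.finrank ℚ K' = 2) : K = K' := by
  have h : ∀ {K K' : IntermediateField ℚ N}, Module.finrank ℚ K = 2 → Module.finrank ℚ K' = 2 →
      K'.fixingSubgroup ≤ K.fixingSubgroup := by
    intro K K' hK hK'
    apply le_of_card_odd_of_index_two
    · rw [index_fixingSubgroup, hK]
    · rwa [IsGalois.card_fixingSubgroup_eq_finrank, finrank_top_eq hN two_ne_zero hK']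
  rw [← IsGalois.fixedField_fixingSubgroup K, ← IsGalois.fixedField_fixingSubgroup K',
    le_antisymm (h hK' hK) (h hK hK')]

/-- The nontrivial automorphism of `N/L`; it does not fix `K`. -/
lemma exists_involution (hp : Odd p) (hN : Module.finrank ℚ N = 2 * p)
    {K L : IntermediateField ℚ N} (hK : Module.finrank ℚ K = 2) (hL : Module.finrank ℚ L = p) :
    ∃ t : N ≃ₐ[ℚ] N, t ∉ K.fixingSubgroup ∧
      ∀ x : N, algebraMap L N (Algebra.norm L x) = x * t x := by
  have hLN : Module.finrank L N = 2 := finrank_top_eq (hN.trans (mul_comm _ _)) hp.pos.ne' hL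
  have hcard : Nat.card (N ≃ₐ[L] N) = 2 := by rw [IsGalois.card_aut_eq_finrank, hLN]
  have : IsCyclic (N ≃ₐ[L] N) := isCyclic_of_prime_card (hp := ⟨Nat.prime_two⟩) hcard
  obtain ⟨t, ht⟩ := IsCyclic.exists_generator (α := N ≃ₐ[L] N)
  have ho := orderOf_generator hLN ht
  refine ⟨t.restrictScalars ℚ, fun hmem => ?_, fun x => ?_⟩
  · have h1 : (t.restrictScalars ℚ) ^ p = 1 := by
      have := congr_arg Subtype.val (pow_card_eq_one' (x := (⟨_, hmem⟩ : K.fixingSubgroup)))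
      rwa [IsGalois.card_fixingSubgroup_eq_finrank, finrank_top_eq hN two_ne_zero hK] at this
    have h2 : t ^ p = 1 := by
      apply AlgEquiv.restrictScalars_injective ℚ
      exact (map_pow (AlgEquiv.restrictScalarsHom ℚ) t p).trans h1
    have h3 := orderOf_dvd_of_pow_eq_one h2
    rw [ho] at h3
    exact (Nat.not_even_iff_odd.mpr hp) (even_iff_two_dvd.mpr h3)
  · rw [algebraMap_norm_eq_prod hLN ht]
    simp [Finset.prod_range_succ]

/-- The relative principal factors are the same subgroup of `𝓘_N / 𝓘_K` for all subfields `L` of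
degree `p`. -/
lemma relativePrincipalFactors_eq (hp : Odd p) (hN : Module.finrank ℚ N = 2 * p)
    {K L L' : IntermediateField ℚ N} (hK : Module.finrank ℚ K = 2) (hL : Module.finrank ℚ L = p)
    (hL' : Module.finrank ℚ L' = p) :
    relativePrincipalFactors K L N p = relativePrincipalFactors K L' N p := by
  have h : ∀ {L L' : IntermediateField ℚ N}, Module.finrank ℚ L = p → Module.finrank ℚ L' = p →
      relativePrincipalFactors K L N p ≤ relativePrincipalFactors K L' N p := by
    intro L L' hL hL'
    obtain ⟨t, htK, ht⟩ := exists_involution hp hN hK hL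
    obtain ⟨t', htK', ht'⟩ := exists_involution hp hN hK hL'
    have hmem : t⁻¹ * t' ∈ K.fixingSubgroup := by
      rw [Subgroup.mul_mem_iff_of_index_two (by rw [index_fixingSubgroup, hK]), inv_mem_iff]
      exact iff_of_false htK htK'
    have hN' := hN.trans (mul_comm _ _)
    refine relativePrincipalFactors_le hp (finrank_top_eq hN' hp.pos.ne' hL)
      (finrank_top_eq hN' hp.pos.ne' hL') (norm_algebraMap_eq hp hN hK hL)
      (norm_algebraMap_eq hp hN hK hL') ht ht' (K.fixingSubgroupEquiv ⟨_, hmem⟩) fun x => ?_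
    exact (AlgEquiv.apply_symm_apply t (t' x)).symm
  exact le_antisymm (h hL hL') (h hL' hL)

end GaloisGroup

/-! ### The table of types -/

section Table

lemma DPFType.ext {T T' : DPFType} (hU : T.U = T'.U) (hA : T.A = T'.A) (hR : T.R = T'.R)
    (hC : T.C = T'.C) : T = T' := by
  cases T <;> cases T' <;> first
    | rfl
    | exact absurd hU (by decide)
    | exact absurd hA (by decide)
    | exact absurd hR (by decide)

/-- The table of types lists all solutions of `U + 1 = A + R + C` with `U ≤ 1`. -/
lemma DPFType.existsUnique_iff (U A R C : ℕ) : (U ≤ 1 ∧ U + 1 = A + R + C) ↔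
    ∃! T : DPFType, T.U = U ∧ T.A = A ∧ T.R = R ∧ T.C = C := by
  constructor
  · rintro ⟨hU, hsum⟩
    have hex : ∃ T : DPFType, T.U = U ∧ T.A = A ∧ T.R = R ∧ T.C = C := by
      obtain rfl : C = U + 1 - A - R := by omega
      have hA : A ≤ U + 1 := by omega
      have hR : R ≤ U + 1 - A := by omega
      interval_cases U <;> interval_cases A <;> interval_cases R
      exacts [⟨.δ₁, rfl, rfl, rfl, rfl⟩, ⟨.δ₂, rfl, rfl, rfl, rfl⟩, ⟨.ε, rfl, rfl, rfl, rfl⟩,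
        ⟨.α₁, rfl, rfl, rfl, rfl⟩, ⟨.α₂, rfl, rfl, rfl, rfl⟩, ⟨.α₃, rfl, rfl, rfl, rfl⟩,
        ⟨.β₁, rfl, rfl, rfl, rfl⟩, ⟨.β₂, rfl, rfl, rfl, rfl⟩, ⟨.γ, rfl, rfl, rfl, rfl⟩]
    obtain ⟨T, hU, hA, hR, hC⟩ := hex
    refine ⟨T, ⟨hU, hA, hR, hC⟩, ?_⟩
    rintro T' ⟨hU', hA', hR', hC'⟩
    exact DPFType.ext (hU'.trans hU.symm) (hA'.trans hA.symm) (hR'.trans hR.symm)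
      (hC'.trans hC.symm)
  · rintro ⟨T, ⟨rfl, rfl, rfl, rfl⟩, -⟩
    cases T <;> decide

end Table

end DPF

theorem theorem4p6 (p : ℕ) (hp : p.Prime) (hp_odd : p ≠ 2)
    (N : Type*) [Field N] [NumberField N] [IsGalois ℚ N] [NumberField.IsTotallyReal N]
    (hN : Nonempty ((N ≃ₐ[ℚ] N) ≃* DihedralGroup p)) :
    (∃! T : DPF.DPFType, DPF.IsOfType p N T) ∧
      (∀ U A R C : ℕ, (U ≤ 1 ∧ U + 1 = A + R + C) ↔
        ∃! T : DPF.DPFType, T.U = U ∧ T.A = A ∧ T.R = R ∧ T.C = C) := by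
  refine ⟨?_, DPF.DPFType.existsUnique_iff⟩
  have hodd : Odd p := hp.odd_of_ne_two hp_odd
  have hdeg : Module.finrank ℚ N = 2 * p := by
    obtain ⟨e⟩ := hN
    rw [← IsGalois.card_aut_eq_finrank, Nat.card_congr e.toEquiv, DihedralGroup.nat_card]
  have hdeg' : Module.finrank ℚ N = p * 2 := hdeg.trans (mul_comm _ _)
  obtain ⟨K, hK⟩ := DPF.exists_intermediateField_finrank_eq hp hdeg'
  obtain ⟨L₀, hL₀⟩ := DPF.exists_intermediateField_finrank_eq Nat.prime_two hdeg
  have hKN : Module.finrank K N = p := DPF.finrank_top_eq hdeg two_ne_zero hK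
  have : IsCyclic (N ≃ₐ[K] N) := isCyclic_of_prime_card (p := p) (hp := ⟨hp⟩)
    (by rw [IsGalois.card_aut_eq_finrank, hKN])
  obtain ⟨g, hg⟩ := IsCyclic.exists_generator (α := N ≃ₐ[K] N)
  have hinv : ∀ L : IntermediateField ℚ N, Module.finrank ℚ L = p →
      ∃ U A R C : ℕ, DPF.HasInvariants p K L N U A R C ∧ U ≤ 1 ∧ U + 1 = A + R + C := fun L hL =>
    DPF.exists_hasInvariants hp hp_odd hKN hK hg (DPF.finrank_top_eq hdeg' hp.ne_zero hL)
      (DPF.norm_algebraMap_eq hodd hdeg hK hL)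
  obtain ⟨U, A, R, C, h₀, hU, hsum⟩ := hinv L₀ hL₀
  obtain ⟨T, ⟨rfl, rfl, rfl, rfl⟩, -⟩ := (DPF.DPFType.existsUnique_iff U A R C).mp ⟨hU, hsum⟩
  refine ⟨T, fun K' L hK' hL => ?_, fun T' hT' => ?_⟩
  · obtain rfl := DPF.quadratic_subfield_unique hodd hdeg hK hK'
    obtain ⟨U', A', R', C', h, -, hsum'⟩ := hinv L hL
    -- `U`, `R` and `C` do not involve `L`, and they determine `A`
    have hrel := h₀.relative
    rw [DPF.relativePrincipalFactors_eq hodd hdeg hK hL₀ hL] at hrel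
    have : Fact p.Prime := ⟨hp⟩
    have hinj := Nat.pow_right_injective hp.two_le
    have hU' : U' = T.U := hinj (h.unit_index.symm.trans h₀.unit_index)
    have hR' : R' = T.R := hinj (h.relative.card_eq.symm.trans hrel.card_eq)
    have hC' : C' = T.C := hinj (h.capitulation.card_eq.symm.trans h₀.capitulation.card_eq)
    have hA' : A' = T.A := by omega
    rwa [hU', hA', hR', hC'] at h
  · obtain ⟨h1, h2, h3, h4⟩ := DPF.HasInvariants.unique hp (hT' K L₀ hK hL₀) h₀
    exact DPF.DPFType.ext h1 h2 h3 h4
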